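/- Work over $\mathbb{C}$. Let $S_6\subset\mathbb{P}^6$ be the sextic Del Pezzo surface that is the (Zariski closure of the) image of $\mathbb{P}^2$ under $$[u_0:u_1:u_2]\mapsto[u_1^2u_2:u_1u_2^2:u_0^2u_2:u_0u_2^2:u_0^2u_1:u_0u_1^2:u_0u_1u_2],$$ let $\sigma$ be the involution $([y_0:y_1],[x_0:\dots:x_6])\mapsto([y_0:-y_1],[x_2:x_4:x_0:x_5:x_1:x_3:x_6])$ of $\mathbb{P}^1\times S_6$, and let $W_{BS}^{10}\subset\mathbb{P}^{10}$ be the Bayle--Sano Enriques--Fano threefold of genus $10$, that is, the quotient of $\mathbb{P}^1\times S_6$ by $\sigma$ realised as the image of $\mathbb{P}^1\times S_6$ under the map $\varphi$ with coordinates $w_0,\dots,w_{10}$ given by $$y_0^2x_6,\ y_0^2(x_0+x_2),\ y_0^2(x_1+x_4),\ y_0^2(x_3+x_5),\ y_1^2x_6,\ y_1^2(x_0+x_2),\ y_1^2(x_1+x_4),\ y_1^2(x_3+x_5),$$ $$y_0y_1(x_0-x_2),\ y_0y_1(x_1-x_4),\ y_0y_1(x_3-x_5).$$ For $i=1,2,3,4$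 put $P_i=\varphi([0:1]\times d_i)$ and $P_i'=\varphi([1:0]\times d_i)$, where $d_1=[1:1:1:1:1:1:1]$, $d_2=[1:-1:1:-1:-1:-1:1]$, $d_3=[-1:1:-1:-1:1:-1:1]$, $d_4=[-1:-1:-1:1:-1:1:1]$; these are the images of the eight fixed points of $\sigma$. Let $T\subset\mathbb{P}^3$ be a tetrahedron with vertices $v_0,\dots,v_3$, let $f_i$ be the face opposite to $v_i$, and let $l_{ij}=f_i\cap f_j$ $(0\le i<j\le 3)$ be its six edges. Let $\pi$ be a plane through $v_0$ that intersects $f_i$ in a line $r_i$ for $i=1,2,3$, where the lines $r_1,r_2,r_3$ are pairwise distinct. Let $\mathcal{M}$ be the linear system of the sextic surfaces of $\mathbb{P}^3$ that have multiplicity at least $4$ at $v_0$, at least $3$ at $v_1,v_2,v_3$, and at least $2$ along $r_1,r_2,r_3$. Then: (a) $\mathcal{M}$ is given by an $11$-dimensional vector space of forms, and for a suitable basis of it the (Zariski closure of the) image of the rational map $\nu_{\mathcal{M}}:\mathbb{P}^3\dashrightarrow\mathbb{P}^{10}$ is $W_{BS}^{10}$. For the same basis, $\nu_{\mathcal{M}}:\mathbb{P}^3\dashrightarrow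 W_{BS}^{10}$ is birational, and its inverse is the restriction to $W_{BS}^{10}$ of a linear projection $\mathbb{P}^{10}\dashrightarrow\mathbb{P}^3$ whose centre is the linear span of the seven points $P_1,P_2,P_3,P_4,P_1',P_2',P_3'$. (b) Every (in particular, a general) element of $\mathcal{M}$ contains the six edges of $T$. -/

import Mathlib

open scoped LinearAlgebra.Projectivization

namespace EnriquesFano

/-! ### Projective space, Zariski closure, rational maps -/

/-- Complex projective space of dimension `n`, with `n + 1` homogeneous coordinates. -/
abbrev PSpace (n : ℕ) : Type := ℙ ℂ (Fin (n + 1) → ℂ)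

/-- The Zariski closure of a set of points of projective space: the common zeros of all
homogeneous polynomials that vanish on the set. -/
def zariskiClosure {n : ℕ} (A : Set (PSpace n)) : Set (PSpace n) :=
  {p | ∀ (d : ℕ) (G : MvPolynomial (Fin (n + 1)) ℂ), G.IsHomogeneous d →
    (∀ q ∈ A, MvPolynomial.eval q.rep G = 0) → MvPolynomial.eval p.rep G = 0}

/-- `V` is a Zariski-open, Zariski-dense subset of `W`. -/
def IsOpenDenseIn {n : ℕ} (V W : Set (PSpace n)) : Prop :=
  (∃ Z : Set (PSpace n), zariskiClosure Z = Z ∧ V = W \ Z) ∧ W ⊆ zariskiClosure V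

/-- The function on vectors whose coordinates are the given polynomials. -/
noncomputable def polyMap {n m : ℕ} (F : Fin m → MvPolynomial (Fin n) ℂ) :
    (Fin n → ℂ) → (Fin m → ℂ) :=
  fun z i => MvPolynomial.eval z (F i)

/-- The graph of the rational map `[z] ↦ [f z]` between projective spaces, where the coordinates
of `f` are homogeneous polynomials of one common degree: `p` is a point at which the coordinates
of `f` do not all vanish, and `q` is its image. -/
def Maps {n m : ℕ} (f : (Fin (n + 1) → ℂ) → (Fin (m + 1) → ℂ))
    (p : PSpace n) (q : PSpace m) : Prop :=
  ∃ (z : Fin (n + 1) → ℂ) (hz : z ≠ 0) (hw : f z ≠ 0),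
    p = Projectivization.mk ℂ z hz ∧ q = Projectivization.mk ℂ (f z) hw

/-- The image of projective space under the rational map `[z] ↦ [f z]`: the Zariski closure of
the set of the images of the points at which the coordinates of `f` do not all vanish. -/
def ratImage {n m : ℕ} (f : (Fin (n + 1) → ℂ) → (Fin (m + 1) → ℂ)) : Set (PSpace m) :=
  zariskiClosure {q | ∃ p, Maps f p q}

/-- The rational maps `[z] ↦ [f z]`, from `Y` to `W`, and `[w] ↦ [g w]`, from `W` to `Y`, are
birational and inverse to each other: they restrict to mutually inverse bijections between a
dense open subset of `Y` and a dense open subset of `W`. -/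
def AreInverseBirational {n m : ℕ} (f : (Fin (n + 1) → ℂ) → (Fin (m + 1) → ℂ))
    (g : (Fin (m + 1) → ℂ) → (Fin (n + 1) → ℂ))
    (Y : Set (PSpace n)) (W : Set (PSpace m)) : Prop :=
  ∃ (U : Set (PSpace n)) (V : Set (PSpace m)), IsOpenDenseIn U Y ∧ IsOpenDenseIn V W ∧
    (∀ p ∈ U, ∃ q ∈ V, Maps f p q ∧ Maps g q p) ∧
    (∀ q ∈ V, ∃ p ∈ U, Maps g q p ∧ Maps f p q)

/-! ### The threefold -/

/-- The map given by the plane cubics through the three coordinate points. -/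
def cubicMap (u : Fin 3 → ℂ) : Fin 7 → ℂ :=
  ![u 1 ^ 2 * u 2, u 1 * u 2 ^ 2, u 0 ^ 2 * u 2, u 0 * u 2 ^ 2, u 0 ^ 2 * u 1, u 0 * u 1 ^ 2,
    u 0 * u 1 * u 2]

/-- The smooth sextic Del Pezzo surface in `ℙ⁶`. -/
def sexticDelPezzo : Set (PSpace 6) := ratImage (n := 2) (m := 6) cubicMap

/-- The forms of bidegree `(2, 1)` that are invariant under the involution
`([y₀ : y₁], [x₀ : ⋯ : x₆]) ↦ ([y₀ : -y₁], [x₂ : x₄ : x₀ : x₅ : x₁ : x₃ : x₆])`. -/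
def quotientMap (y : Fin 2 → ℂ) (x : Fin 7 → ℂ) : Fin 11 → ℂ :=
  ![y 0 ^ 2 * x 6, y 0 ^ 2 * (x 0 + x 2), y 0 ^ 2 * (x 1 + x 4), y 0 ^ 2 * (x 3 + x 5),
    y 1 ^ 2 * x 6, y 1 ^ 2 * (x 0 + x 2), y 1 ^ 2 * (x 1 + x 4), y 1 ^ 2 * (x 3 + x 5),
    y 0 * y 1 * (x 0 - x 2), y 0 * y 1 * (x 1 - x 4), y 0 * y 1 * (x 3 - x 5)]

/-- The Bayle-Sano Enriques-Fano threefold of genus 10 in `ℙ¹⁰`: the quotient of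
`ℙ¹ × S₆`, with `S₆` the sextic Del Pezzo surface, by the above involution, realised as
the image of `ℙ¹ × S₆` under the morphism given by the invariant forms. -/
def threefold : Set (PSpace 10) :=
  {w | ∃ (y : Fin 2 → ℂ) (x : Fin 7 → ℂ) (_ : y ≠ 0) (hx : x ≠ 0) (hw : quotientMap y x ≠ 0),
    Projectivization.mk ℂ x hx ∈ sexticDelPezzo ∧
      w = Projectivization.mk ℂ (quotientMap y x) hw}

/-- The four fixed points of the involution on the sextic Del Pezzo surface. -/
def delPezzoFixed : Fin 4 → (Fin 7 → ℂ) :=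
  ![![1, 1, 1, 1, 1, 1, 1], ![1, -1, 1, -1, -1, -1, 1], ![-1, 1, -1, -1, 1, -1, 1],
    ![-1, -1, -1, 1, -1, 1, 1]]

/-- The singular points `P₁, P₂, P₃, P₄` of the threefold (as vectors of coordinates), given as the
images of the fixed points `[0 : 1] × dᵢ` of the involution. -/
def pointP (i : Fin 4) : Fin 11 → ℂ := quotientMap ![0, 1] (delPezzoFixed i)

/-- The singular points `P₁', P₂', P₃', P₄'` of the threefold (as vectors of coordinates), given as
the images of the fixed points `[1 : 0] × dᵢ` of the involution. -/
def pointP' (i : Fin 4) : Fin 11 → ℂ := quotientMap ![1, 0] (delPezzoFixed i)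

/-- The linear subspace spanned by `P₁, P₂, P₃, P₄, P₁', P₂', P₃'`. -/
def projectionCentre : Submodule ℂ (Fin 11 → ℂ) :=
  Submodule.span ℂ {pointP 0, pointP 1, pointP 2, pointP 3, pointP' 0, pointP' 1, pointP' 2}

/-! ### The linear system of sextics -/

/-- The polynomial `F` has multiplicity at least `m` at the vector `a`: its Taylor expansion at
`a` has no terms of degree less than `m`. -/
def MultAt {n : ℕ} (F : MvPolynomial (Fin n) ℂ) (a : Fin n → ℂ) (m : ℕ) : Prop :=
  ∀ e : Fin n →₀ ℕ, e.degree < m →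
    MvPolynomial.coeff e
      (MvPolynomial.aeval (fun i => MvPolynomial.X i + MvPolynomial.C (a i)) F :
        MvPolynomial (Fin n) ℂ) = 0

/-- The hypersurface `F = 0` has multiplicity at least `m` at every point of the projective
linear subspace that corresponds to the vector subspace `S`. -/
def MultAlong {n : ℕ} (F : MvPolynomial (Fin n) ℂ) (S : Submodule ℂ (Fin n → ℂ)) (m : ℕ) : Prop :=
  ∀ a ∈ S, a ≠ 0 → MultAt F a m

/-- The face opposite to the vertex `v i` of the tetrahedron with vertices `v`. -/
noncomputable def face (v : Fin 4 → PSpace 3) (i : Fin 4) : Submodule ℂ (Fin 4 → ℂ) :=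
  ⨆ (j : Fin 4) (_ : j ≠ i), (v j).submodule

/-- The edge in which two faces meet. -/
noncomputable def edge (v : Fin 4 → PSpace 3) (i j : Fin 4) : Submodule ℂ (Fin 4 → ℂ) :=
  face v i ⊓ face v j

/-- The intersection of the plane `H` with a face. -/
noncomputable def trace (v : Fin 4 → PSpace 3) (H : Submodule ℂ (Fin 4 → ℂ)) (i : Fin 4) :
    Submodule ℂ (Fin 4 → ℂ) :=
  H ⊓ face v i

/-- The sextic surfaces that are (at least) quadruple at `v 0`, triple at `v 1`, `v 2`, `v 3`, and
double along the intersections of `H` with the faces opposite to `v 1`, `v 2`, `v 3`. -/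
noncomputable def sexticSystem (v : Fin 4 → PSpace 3) (H : Submodule ℂ (Fin 4 → ℂ)) :
    Submodule ℂ (MvPolynomial (Fin 4) ℂ) where
  carrier := {F | F.IsHomogeneous 6 ∧ MultAlong F (v 0).submodule 4 ∧
    (∀ i, i ≠ 0 → MultAlong F (v i).submodule 3) ∧
    (∀ i, i ≠ 0 → MultAlong F (trace v H i) 2)}
  zero_mem' := by
    refine ⟨MvPolynomial.isHomogeneous_zero _ _ _, ?_, ?_, ?_⟩ <;>
      simp [MultAlong, MultAt]
  add_mem' := by
    rintro F G ⟨hF, hF0, hF1, hF2⟩ ⟨hG, hG0, hG1, hG2⟩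
    have key : ∀ (S : Submodule ℂ (Fin 4 → ℂ)) (m : ℕ), MultAlong F S m → MultAlong G S m →
        MultAlong (F + G) S m := by
      intro S m h1 h2 a ha ha0 e he
      rw [map_add, MvPolynomial.coeff_add, h1 a ha ha0 e he, h2 a ha ha0 e he, add_zero]
    exact ⟨hF.add hG, key _ _ hF0 hG0, fun i hi => key _ _ (hF1 i hi) (hG1 i hi),
      fun i hi => key _ _ (hF2 i hi) (hG2 i hi)⟩
  smul_mem' := by
    rintro c F ⟨hF, hF0, hF1, hF2⟩
    have key : ∀ (S : Submodule ℂ (Fin 4 → ℂ)) (m : ℕ), MultAlong F S m →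
        MultAlong (c • F) S m := by
      intro S m h1 a ha ha0 e he
      rw [map_smul, MvPolynomial.coeff_smul, h1 a ha ha0 e he, smul_zero]
    exact ⟨(MvPolynomial.homogeneousSubmodule (Fin 4) ℂ 6).smul_mem c hF, key _ _ hF0,
      fun i hi => key _ _ (hF1 i hi), fun i hi => key _ _ (hF2 i hi)⟩

end EnriquesFano

namespace EnriquesFano

open MvPolynomial

/-! ### Homogeneous polynomials and the Zariski closure -/

/-! Choose coordinates `t₀, …, t₃` in which the vertices are the coordinate points and the plane `π`
is `l = 0` with `l = t₁ + t₂ + t₃` (`exists_adapted_coordinates`). The multiplicities at the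
vertices bound the degree of a sextic of the system in each coordinate, which leaves 34 monomials.
The vanishing of the first partial derivatives along the lines `rᵢ` then leaves an 11-dimensional
space, spanned by products of `t₀, l, t₁, t₂, t₃` (`exists_eq_sum_sexticGenerator`). Part (b) is
visible on these products.

Four of the products are `t₀² l`, and four others are `t₁ t₂ t₃`, times the cubics `t₁t₂t₃, l t₂t₃,
l t₁t₃, l t₁t₂`, which parametrize Cayley's four-nodal cubic surface. That surface is also the
quotient of `S₆` by `σ`: a point of `S₆` is a `3 × 3` matrix of rank one with constant diagonal, `σ`
transposes it, and its symmetric part is singular. Conversely, a singular symmetric matrix with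
constant diagonal determines the antisymmetric part up to sign (`exists_antisymmetric_part`). So
`ThreefoldEquations`, which hold for the sextics, force a point to lie on the threefold. The reverse
inclusion holds because a general point of the threefold is a value of the sextics
(`sexticValue_quotient`) and the image is closed.

The product `t₀² l t₁t₂t₃` and the three remaining ones are the quintic `t₀ l t₁t₂t₃` times `t₀, t₁,
t₂, t₃`. A linear projection that isolates these four is therefore a left inverse of the
parametrization up to a scalar factor, which implies birationality
(`areInverseBirational_of_linear_leftInverse`). Its kernel is the span of the seven points. -/

theorem eval_smul_of_isHomogeneous {σ : Type*} {d : ℕ} {G : MvPolynomial σ ℂ}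
    (hG : G.IsHomogeneous d) (c : ℂ) (z : σ → ℂ) :
    eval (c • z) G = c ^ d * eval z G := by
  rw [eval_eq, eval_eq, Finset.mul_sum]
  refine Finset.sum_congr rfl fun e he => ?_
  have hd : ∑ i ∈ e.support, e i = d := by
    simpa [Finsupp.degree] using hG.degree_eq_sum_deg_support he |>.symm
  simp only [Pi.smul_apply, smul_eq_mul, mul_pow, Finset.prod_mul_distrib,
    Finset.prod_pow_eq_pow_sum, hd]
  ring

theorem eval_zero_of_isHomogeneous {σ : Type*} {d : ℕ} {G : MvPolynomial σ ℂ}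
    (hG : G.IsHomogeneous d) (hd : d ≠ 0) : eval (0 : σ → ℂ) G = 0 := by
  have := eval_smul_of_isHomogeneous hG 0 0
  simpa [hd] using this

theorem eval_rep_mk {n d : ℕ} {G : MvPolynomial (Fin (n + 1)) ℂ} (hG : G.IsHomogeneous d)
    (z : Fin (n + 1) → ℂ) (hz : z ≠ 0) :
    eval (Projectivization.mk ℂ z hz).rep G = 0 ↔ eval z G = 0 := by
  obtain ⟨a, ha⟩ := Projectivization.exists_smul_eq_mk_rep ℂ z hz
  rw [← ha, Units.smul_def, eval_smul_of_isHomogeneous hG]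
  simp

theorem mk_mem_zariskiClosure {n : ℕ} {A : Set (PSpace n)} {w : Fin (n + 1) → ℂ} {hw : w ≠ 0} :
    Projectivization.mk ℂ w hw ∈ zariskiClosure A ↔
      ∀ (d : ℕ) (G : MvPolynomial (Fin (n + 1)) ℂ), G.IsHomogeneous d →
        (∀ (z : Fin (n + 1) → ℂ) (hz : z ≠ 0), Projectivization.mk ℂ z hz ∈ A → eval z G = 0) →
          eval w G = 0 := by
  constructor
  · intro h d G hG hA
    rw [← eval_rep_mk hG w hw]
    refine h d G hG fun q hq => hA _ q.rep_nonzero ?_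
    rwa [Projectivization.mk_rep]
  · intro h d G hG hA
    rw [eval_rep_mk hG w hw]
    exact h d G hG fun z hz hzA => (eval_rep_mk hG z hz).1 (hA _ hzA)

theorem mk_mem_ratImage {n m : ℕ} {f : (Fin (n + 1) → ℂ) → (Fin (m + 1) → ℂ)}
    {w : Fin (m + 1) → ℂ} {hw : w ≠ 0} :
    Projectivization.mk ℂ w hw ∈ ratImage f ↔
      ∀ (d : ℕ) (G : MvPolynomial (Fin (m + 1)) ℂ), G.IsHomogeneous d →
        (∀ z, z ≠ 0 → f z ≠ 0 → eval (f z) G = 0) → eval w G = 0 := by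
  rw [ratImage, mk_mem_zariskiClosure]
  constructor
  · intro h d G hG hA
    refine h d G hG ?_
    rintro y hy ⟨p, z, hz, hfz, -, hq⟩
    rw [← eval_rep_mk hG y hy, hq, eval_rep_mk hG]
    exact hA z hz hfz
  · intro h d G hG hA
    exact h d G hG fun z hz hfz => hA _ hfz ⟨_, z, hz, hfz, rfl, rfl⟩

theorem subset_zariskiClosure {n : ℕ} (A : Set (PSpace n)) : A ⊆ zariskiClosure A :=
  fun _ hp _ _ _ hA => hA _ hp

theorem zariskiClosure_zeroLocus {n d : ℕ} {G : MvPolynomial (Fin (n + 1)) ℂ}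
    (hG : G.IsHomogeneous d) :
    zariskiClosure {p : PSpace n | eval p.rep G = 0} = {p : PSpace n | eval p.rep G = 0} :=
  Set.Subset.antisymm (fun _ hp => hp d G hG fun _ hq => hq) (subset_zariskiClosure _)

/-! ### Linear substitutions -/

/-- The substitution of a linear map into polynomials. -/
noncomputable def linSubst {k l : ℕ} (ρ : (Fin l → ℂ) →ₗ[ℂ] (Fin k → ℂ)) :
    MvPolynomial (Fin k) ℂ →ₐ[ℂ] MvPolynomial (Fin l) ℂ :=
  aeval fun i => ∑ j, C (ρ (Pi.single j 1) i) * X j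

theorem eval_linSubst {k l : ℕ} (ρ : (Fin l → ℂ) →ₗ[ℂ] (Fin k → ℂ)) (G : MvPolynomial (Fin k) ℂ)
    (w : Fin l → ℂ) : eval w (linSubst ρ G) = eval (ρ w) G := by
  have key : ∀ i, eval w (∑ j, C (ρ (Pi.single j 1) i) * X j) = ρ w i := by
    intro i
    conv_rhs => rw [← LinearMap.sum_single_apply (fun _ => ℂ) w, map_sum]
    simp only [map_sum, map_mul, eval_C, eval_X, Finset.sum_apply]
    refine Finset.sum_congr rfl fun j _ => ?_
    have : (Pi.single j (w j) : Fin l → ℂ) = w j • Pi.single j 1 := by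
      rw [← Pi.single_smul, smul_eq_mul, mul_one]
    rw [this, map_smul, Pi.smul_apply, smul_eq_mul, mul_comm]
  have h : (aeval w : MvPolynomial (Fin l) ℂ →ₐ[ℂ] ℂ).comp (linSubst ρ) = aeval (ρ w) := by
    ext i
    simpa [linSubst, aeval_eq_eval] using key i
  simpa [aeval_eq_eval] using DFunLike.congr_fun h G

theorem IsHomogeneous.linSubst {k l d : ℕ} (ρ : (Fin l → ℂ) →ₗ[ℂ] (Fin k → ℂ))
    {G : MvPolynomial (Fin k) ℂ} (hG : G.IsHomogeneous d) :
    (EnriquesFano.linSubst ρ G).IsHomogeneous d := by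
  have := hG.aeval (n := 1) (fun i => ∑ j, C (ρ (Pi.single j 1) i) * X j)
    fun i => IsHomogeneous.sum _ _ _ fun j _ => isHomogeneous_C_mul_X _ _
  rwa [one_mul] at this

/-! ### A criterion for birationality -/

theorem exists_smul_eq_of_minors {n : ℕ} {a b : Fin n → ℂ} (ha : a ≠ 0)
    (h : ∀ i j, a i * b j = a j * b i) : ∃ c : ℂ, b = c • a := by
  obtain ⟨i, hi⟩ := Function.ne_iff.1 ha
  refine ⟨b i / a i, funext fun j => ?_⟩
  have hi' : a i ≠ 0 := hi
  simp only [Pi.smul_apply, smul_eq_mul]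
  field_simp
  linear_combination h i j

theorem eval_bind₁_eq {k l : ℕ} (F : Fin l → MvPolynomial (Fin k) ℂ) (G : MvPolynomial (Fin l) ℂ)
    (z : Fin k → ℂ) : eval z (bind₁ F G) = eval (polyMap F z) G := by
  simp only [← aeval_eq_eval, aeval_bind₁]
  rfl

/-- The complement of a hypersurface is dense: `δ * G` vanishes everywhere, and the polynomial ring
is a domain. -/
theorem eq_zero_of_eval_mul {σ : Type*} {G δ : MvPolynomial σ ℂ} (hδ : δ ≠ 0)
    (h : ∀ z, eval z δ ≠ 0 → eval z G = 0) : G = 0 := by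
  have : δ * G = 0 := by
    refine MvPolynomial.funext fun z => ?_
    by_cases hz : eval z δ = 0
    · simp [hz]
    · simp [h z hz]
  exact (mul_eq_zero.1 this).resolve_left hδ

/-- A rational map with a linear left inverse is birational onto its image. -/
theorem areInverseBirational_of_linear_leftInverse {n m d k : ℕ}
    {F : Fin (m + 1) → MvPolynomial (Fin (n + 1)) ℂ} (hF : ∀ i, (F i).IsHomogeneous d)
    (ρ : (Fin (m + 1) → ℂ) →ₗ[ℂ] (Fin (n + 1) → ℂ)) {δ : MvPolynomial (Fin (n + 1)) ℂ}
    (hδ : δ.IsHomogeneous k) (hk : k ≠ 0) (hδ0 : δ ≠ 0)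
    (h : ∀ z, ρ (polyMap F z) = eval z δ • z) :
    AreInverseBirational (polyMap F) ρ Set.univ (ratImage (polyMap F)) := by
  have ne_zero : ∀ z, eval z δ ≠ 0 → z ≠ 0 := by
    rintro z hz rfl
    exact hz (eval_zero_of_isHomogeneous hδ hk)
  have map_ne_zero : ∀ z, eval z δ ≠ 0 → polyMap F z ≠ 0 := by
    intro z hz h0
    have := h z
    rw [h0, map_zero] at this
    exact smul_ne_zero hz (ne_zero z hz) this.symm
  have hδρ := IsHomogeneous.linSubst ρ hδ
  have hFsmul : ∀ (c : ℂ) z, polyMap F (c • z) = c ^ d • polyMap F z := by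
    intro c z
    funext i
    exact eval_smul_of_isHomogeneous (hF i) c z
  have hδρF : ∀ z, eval z δ ≠ 0 → eval (polyMap F z) (linSubst ρ δ) ≠ 0 := by
    intro z hz
    rw [eval_linSubst, h, eval_smul_of_isHomogeneous hδ]
    exact mul_ne_zero (pow_ne_zero _ hz) hz
  have mem_ratImage : ∀ z (hz : eval z δ ≠ 0),
      Projectivization.mk ℂ (polyMap F z) (map_ne_zero z hz) ∈ ratImage (polyMap F) := by
    intro z hz
    exact subset_zariskiClosure _ ⟨_, z, ne_zero z hz, map_ne_zero z hz, rfl, rfl⟩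
  -- The open sets are `δ ≠ 0` in the source and `δ ∘ ρ ≠ 0` in the image.
  refine ⟨{p | eval p.rep δ = 0}ᶜ, ratImage (polyMap F) \ {q | eval q.rep (linSubst ρ δ) = 0},
    ⟨⟨_, zariskiClosure_zeroLocus hδ, Set.compl_eq_univ_sdiff _⟩, ?_⟩,
    ⟨⟨_, zariskiClosure_zeroLocus hδρ, rfl⟩, ?_⟩, ?_, ?_⟩
  · intro p _ e G hG hA
    have : G = 0 := by
      refine eq_zero_of_eval_mul hδ0 fun z hz => ?_
      rw [← eval_rep_mk hG z (ne_zero z hz)]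
      refine hA _ ?_
      simpa [eval_rep_mk hδ] using hz
    simp [this]
  · intro p hp e G hG hA
    refine hp e G hG ?_
    rintro q ⟨_, z, hz, hfz, -, rfl⟩
    rw [eval_rep_mk hG]
    -- Density of the open part of the image: the pullback of `G` vanishes where `δ ≠ 0`, hence
    -- identically.
    have : (bind₁ F G : MvPolynomial (Fin (n + 1)) ℂ) = 0 := by
      refine eq_zero_of_eval_mul hδ0 fun y hy => ?_
      have h1 : eval (polyMap F y) G = 0 := by
        rw [← eval_rep_mk hG _ (map_ne_zero y hy)]
        refine hA _ ⟨mem_ratImage y hy, ?_⟩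
        simpa [eval_rep_mk hδρ] using hδρF y hy
      rwa [eval_bind₁_eq]
    have h2 := congrArg (eval z) this
    rwa [eval_bind₁_eq, map_zero] at h2
  · intro p
    induction p using Projectivization.ind with | _ z hz => ?_
    intro hp
    have hp : eval z δ ≠ 0 := by simpa [eval_rep_mk hδ] using hp
    refine ⟨_, ⟨mem_ratImage z hp, ?_⟩, ⟨z, hz, map_ne_zero z hp, rfl, rfl⟩, ?_⟩
    · simpa [eval_rep_mk hδρ] using hδρF z hp
    · refine ⟨_, map_ne_zero z hp, ?_, rfl, ?_⟩
      · rw [h]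
        exact smul_ne_zero hp hz
      · rw [Projectivization.mk_eq_mk_iff']
        exact ⟨(eval z δ)⁻¹, by simp [h, smul_smul, hp]⟩
  · intro q
    induction q using Projectivization.ind with | _ w hw => ?_
    rintro ⟨hq, hq0⟩
    have hq0 : eval (ρ w) δ ≠ 0 := by
      rwa [Set.mem_ofPred_eq, eval_rep_mk hδρ, eval_linSubst] at hq0
    have hρ := ne_zero _ hq0
    -- The `2 × 2` minors of `w` and `F (ρ w)` are forms in `w` that vanish at every `w = F z`,
    -- since there `ρ w` is a multiple of `z`. They therefore vanish on the closure, so that `F (ρ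
    -- w)` is proportional to `w`.
    have hmin : ∀ i j, w i * polyMap F (ρ w) j = w j * polyMap F (ρ w) i := by
      intro i j
      let G : MvPolynomial (Fin (m + 1)) ℂ :=
        X i * linSubst ρ (F j) - X j * linSubst ρ (F i)
      have hG : G.IsHomogeneous (1 + d) :=
        ((isHomogeneous_X _ i).mul (IsHomogeneous.linSubst ρ (hF j))).sub
          ((isHomogeneous_X _ j).mul (IsHomogeneous.linSubst ρ (hF i)))
      have := mk_mem_ratImage.1 hq _ G hG fun z _ _ => by
        simp only [G, map_sub, map_mul, eval_X, eval_linSubst, h,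
          eval_smul_of_isHomogeneous (hF _)]
        simp only [polyMap]
        ring
      simp only [G, map_sub, map_mul, eval_X, eval_linSubst] at this
      exact sub_eq_zero.1 this
    obtain ⟨c, hc⟩ := exists_smul_eq_of_minors hw hmin
    have hf := map_ne_zero _ hq0
    refine ⟨Projectivization.mk ℂ (ρ w) hρ, ?_, ⟨w, hw, hρ, rfl, rfl⟩, ⟨ρ w, hρ, hf, rfl, ?_⟩⟩
    · simpa [eval_rep_mk hδ] using hq0
    · rw [Projectivization.mk_eq_mk_iff']
      have hc0 : c ≠ 0 := by
        rintro rfl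
        rw [zero_smul] at hc
        exact hf hc
      exact ⟨c⁻¹, by rw [hc, smul_smul, inv_mul_cancel₀ hc0, one_smul]⟩

/-! ### The sextic Del Pezzo surface -/

/-- A pair with product zero is a limit of pairs with nonzero product. The product is `ε ^ 2` rather
than `ε` so that the pair `(0, 0)` can be deformed to `(ε, ε)`. -/
theorem exists_continuous_product_sq {a b : ℂ} (h : a * b = 0) :
    ∃ p r : ℂ → ℂ, Continuous p ∧ Continuous r ∧ p 0 = a ∧ r 0 = b ∧ ∀ ε, p ε * r ε = ε ^ 2 := by
  by_cases ha : a = 0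
  · by_cases hb : b = 0
    · exact ⟨id, id, continuous_id, continuous_id, by simp [ha], by simp [hb], fun ε => by
        simp [sq]⟩
    · refine ⟨fun ε => ε ^ 2 / b, fun _ => b, by fun_prop, by fun_prop, by simp [ha], rfl,
        fun ε => by field_simp⟩
  · have hb : b = 0 := (mul_eq_zero.1 h).resolve_left ha
    exact ⟨fun _ => a, fun ε => ε ^ 2 / a, by fun_prop, by fun_prop, rfl, by simp [hb],
      fun ε => by field_simp⟩

/-- The off-diagonal entries of the matrix `(uᵢ vⱼ)`, followed by `z`. -/
def rankOneVec (u v : Fin 3 → ℂ) (z : ℂ) : Fin 7 → ℂ :=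
  ![u 1 * v 0, u 2 * v 0, u 0 * v 1, u 2 * v 1, u 0 * v 2, u 1 * v 2, z]

/-- With `vᵢ = z / uᵢ` the vector is `z / (u₀u₁u₂)` times `cubicMap u`. -/
theorem eval_rankOneVec_of_ne_zero {d : ℕ} {G : MvPolynomial (Fin 7) ℂ} (hG : G.IsHomogeneous d)
    (h : ∀ u, cubicMap u ≠ 0 → eval (cubicMap u) G = 0) {u v : Fin 3 → ℂ} {z : ℂ} (hz : z ≠ 0)
    (huv : ∀ i, u i * v i = z) : eval (rankOneVec u v z) G = 0 := by
  have hu : ∀ i, u i ≠ 0 := fun i hi => hz (by rw [← huv i, hi, zero_mul])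
  have hv : ∀ i, v i = z / u i := fun i => by
    rw [← huv i]
    field_simp [hu i]
  have hc : cubicMap u ≠ 0 := fun h0 => by
    have := congrFun h0 6
    simp [cubicMap, hu] at this
  have : rankOneVec u v z = (z / (u 0 * u 1 * u 2)) • cubicMap u := by
    have h0 := hu 0
    have h1 := hu 1
    have h2 := hu 2
    funext i
    fin_cases i <;> simp [rankOneVec, cubicMap, hv] <;> field_simp
  rw [this, eval_smul_of_isHomogeneous hG, h u hc, mul_zero]

/-- Boundary points are limits of matrices with diagonal `ε ^ 2 ≠ 0`, where the previous lemma
applies; continuity of `G` gives the value at `ε = 0`. -/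
theorem eval_rankOneVec_zero {d : ℕ} {G : MvPolynomial (Fin 7) ℂ} (hG : G.IsHomogeneous d)
    (h : ∀ u, cubicMap u ≠ 0 → eval (cubicMap u) G = 0) {u v : Fin 3 → ℂ}
    (huv : ∀ i, u i * v i = 0) : eval (rankOneVec u v 0) G = 0 := by
  choose p r hp hr hp0 hr0 hpr using fun i => exists_continuous_product_sq (huv i)
  let g : ℂ → ℂ := fun ε => eval (rankOneVec (fun i => p i ε) (fun i => r i ε) (ε ^ 2)) G
  have hg : Continuous g := by
    refine (MvPolynomial.continuous_eval G).comp (continuous_pi fun i => ?_)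
    have h1 : ∀ i j, Continuous fun ε => p i ε * r j ε := fun i j => (hp i).mul (hr j)
    fin_cases i
    exacts [h1 1 0, h1 2 0, h1 0 1, h1 2 1, h1 0 2, h1 1 2, continuous_pow 2]
  have hg0 : g = fun _ => 0 :=
    Continuous.ext_on (dense_compl_singleton (0 : ℂ)) hg continuous_const fun ε hε =>
      eval_rankOneVec_of_ne_zero hG h (pow_ne_zero 2 hε) fun i => hpr i ε
  have := congrFun hg0 0
  simpa [g, hp0, hr0] using this

/-- The quadrics through the sextic Del Pezzo surface: the `2 × 2` minors of the matrix with
rows `(x₆, x₂, x₄)`, `(x₀, x₆, x₅)`, `(x₁, x₃, x₆)`. -/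
structure DelPezzoQuadrics (x : Fin 7 → ℂ) : Prop where
  h02 : x 0 * x 2 = x 6 ^ 2
  h14 : x 1 * x 4 = x 6 ^ 2
  h35 : x 3 * x 5 = x 6 ^ 2
  h25 : x 2 * x 5 = x 6 * x 4
  h03 : x 0 * x 3 = x 6 * x 1
  h12 : x 1 * x 2 = x 6 * x 3
  h04 : x 0 * x 4 = x 6 * x 5
  h15 : x 1 * x 5 = x 6 * x 0
  h34 : x 3 * x 4 = x 6 * x 2

theorem DelPezzoQuadrics.mk_mem {x : Fin 7 → ℂ} (hq : DelPezzoQuadrics x) (hx : x ≠ 0) :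
    Projectivization.mk ℂ x hx ∈ sexticDelPezzo := by
  refine mk_mem_ratImage.2 fun d G hG hA => ?_
  have h : ∀ u, cubicMap u ≠ 0 → eval (cubicMap u) G = 0 := by
    intro u hu
    refine hA u ?_ hu
    rintro rfl
    exact hu (by funext i; fin_cases i <;> simp [cubicMap])
  obtain ⟨h02, h14, h35, h25, h03, h12, h04, h15, h34⟩ := hq
  by_cases hz : x 6 = 0
  -- With zero diagonal, the quadrics allow at most two nonzero coordinates, consecutive in the
  -- cyclic order `0, 1, 3, 2, 4, 5`: the point lies on a hexagon of lines. The cases run through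
  -- its sides and vertices and write the point as a `rankOneVec`.
  · simp only [hz, zero_mul, ne_eq, OfNat.ofNat_ne_zero, not_false_eq_true, zero_pow,
      mul_eq_zero] at h02 h14 h35 h25 h03 h12 h04 h15 h34
    have close : ∀ u v : Fin 3 → ℂ, (∀ i, u i * v i = 0) → x = rankOneVec u v 0 →
        eval x G = 0 := fun u v huv hx => hx ▸ eval_rankOneVec_zero hG h huv
    by_cases h0 : x 0 = 0
    · by_cases h1 : x 1 = 0
      · by_cases h2 : x 2 = 0
        · by_cases h3 : x 3 = 0
          · by_cases h4 : x 4 = 0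
            · refine close ![0, x 5, 0] ![0, 0, 1] ?_ ?_
              · intro i; fin_cases i <;> simp
              · funext i; fin_cases i <;> simp [rankOneVec, *]
            · refine close ![x 4, x 5, 0] ![0, 0, 1] ?_ ?_
              · intro i; fin_cases i <;> simp
              · funext i; fin_cases i <;> simp [rankOneVec, *]
          · have h4 := h34.resolve_left h3
            have h5 := h35.resolve_left h3
            refine close ![0, 0, x 3] ![0, 1, 0] ?_ ?_
            · intro i; fin_cases i <;> simp
            · funext i; fin_cases i <;> simp [rankOneVec, *]
        · have h5 := h25.resolve_left h2
          rcases h34 with h3 | h4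
          · refine close ![x 2, 0, 0] ![0, 1, x 4 / x 2] ?_ ?_
            · intro i; fin_cases i <;> simp
            · funext i; fin_cases i <;> simp [rankOneVec, *]
              field_simp
          · refine close ![x 2, 0, x 3] ![0, 1, 0] ?_ ?_
            · intro i; fin_cases i <;> simp
            · funext i; fin_cases i <;> simp [rankOneVec, *]
      · have h2 := h12.resolve_left h1
        have h4 := h14.resolve_left h1
        have h5 := h15.resolve_left h1
        refine close ![0, 0, x 1] ![1, x 3 / x 1, 0] ?_ ?_
        · intro i; fin_cases i <;> simp
        · funext i; fin_cases i <;> simp [rankOneVec, *]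
          field_simp
    · have h2 := h02.resolve_left h0
      have h3 := h03.resolve_left h0
      have h4 := h04.resolve_left h0
      rcases h15 with h1 | h5
      · refine close ![0, x 0, 0] ![1, 0, x 5 / x 0] ?_ ?_
        · intro i; fin_cases i <;> simp
        · funext i; fin_cases i <;> simp [rankOneVec, *]
          field_simp
      · refine close ![0, x 0, x 1] ![1, 0, 0] ?_ ?_
        · intro i; fin_cases i <;> simp
        · funext i; fin_cases i <;> simp [rankOneVec, *]
  · have h0 : x 0 ≠ 0 := fun h0 => hz (by simpa [h0] using h02.symm)
    have h1 : x 1 ≠ 0 := fun h1 => hz (by simpa [h1] using h14.symm)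
    -- The first column of the rank-one matrix is `(x 6, x 0, x 1)`, and the constant diagonal
    -- determines `v`.
    have : x = rankOneVec ![x 6, x 0, x 1] ![1, x 6 / x 0, x 6 / x 1] (x 6) := by
      funext i
      fin_cases i <;> simp [rankOneVec] <;> field_simp
      · linear_combination h02
      · linear_combination h03
      · linear_combination h14
      · linear_combination h15
    rw [this]
    refine eval_rankOneVec_of_ne_zero hG h hz fun i => ?_
    fin_cases i <;> simp <;> field_simp

/-! ### Equations of the threefold -/

/-- Let `S` be the symmetric matrix with diagonal `2z` and off-diagonal entries `a, b, c`; its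
determinant is twice the cubic in `h`. The nine relations say that `k = (r, q, p)` satisfies `k kᵗ =
-adj S` and `S k = 0`. A nonzero diagonal entry of the adjugate gives `p` as a square root, the
products with `p` define `q` and `r`, and the other relations follow after multiplication by `p` or
`p ^ 2`. -/
theorem exists_antisymmetric_part_of_ne {z a b c : ℂ} (ha : a ^ 2 - 4 * z ^ 2 ≠ 0)
    (h : 4 * z ^ 3 + a * b * c - z * (a ^ 2 + b ^ 2 + c ^ 2) = 0) :
    ∃ p q r : ℂ, p ^ 2 = a ^ 2 - 4 * z ^ 2 ∧ q ^ 2 = b ^ 2 - 4 * z ^ 2 ∧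
      r ^ 2 = c ^ 2 - 4 * z ^ 2 ∧ p * q = 2 * z * c - a * b ∧ p * r = 2 * z * b - a * c ∧
      q * r = 2 * z * a - b * c ∧ a * r + c * p + 2 * z * q = 0 ∧ a * q + b * p + 2 * z * r = 0 ∧
      c * q + b * r + 2 * z * p = 0 := by
  obtain ⟨p, hp⟩ := IsAlgClosed.exists_pow_nat_eq (a ^ 2 - 4 * z ^ 2) two_pos
  have hp0 : p ≠ 0 := by
    rintro rfl
    exact ha (by rw [← hp]; simp)
  obtain ⟨q, hq⟩ : ∃ q, p * q = 2 * z * c - a * b := ⟨(2 * z * c - a * b) / p, by field_simp⟩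
  obtain ⟨r, hr⟩ : ∃ r, p * r = 2 * z * b - a * c := ⟨(2 * z * b - a * c) / p, by field_simp⟩
  have hp2 : p ^ 2 ≠ 0 := pow_ne_zero 2 hp0
  refine ⟨p, q, r, hp, ?_, ?_, hq, hr, ?_, ?_, ?_, ?_⟩
  · refine mul_left_cancel₀ hp2 ?_
    linear_combination (p * q + (2 * z * c - a * b)) * hq - (b ^ 2 - 4 * z ^ 2) * hp - 4 * z * h
  · refine mul_left_cancel₀ hp2 ?_
    linear_combination (p * r + (2 * z * b - a * c)) * hr - (c ^ 2 - 4 * z ^ 2) * hp - 4 * z * h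
  · refine mul_left_cancel₀ hp2 ?_
    linear_combination p * r * hq + (2 * z * c - a * b) * hr - (2 * z * a - b * c) * hp + 2 * a * h
  · refine mul_left_cancel₀ hp0 ?_
    linear_combination a * hr + 2 * z * hq + c * hp
  · refine mul_left_cancel₀ hp0 ?_
    linear_combination a * hq + 2 * z * hr + b * hp
  · refine mul_left_cancel₀ hp0 ?_
    linear_combination c * hq + b * hr + 2 * z * hp - 2 * h

/-- If some diagonal entry of `adj S` is nonzero, a permutation of `a, b, c` reduces to the previous
lemma. Otherwise `adj S = 0`, because modulo `det S` the squares of its off-diagonal entries are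
products of diagonal ones, and `k = 0` works. -/
theorem exists_antisymmetric_part {z a b c : ℂ}
    (h : 4 * z ^ 3 + a * b * c - z * (a ^ 2 + b ^ 2 + c ^ 2) = 0) :
    ∃ p q r : ℂ, p ^ 2 = a ^ 2 - 4 * z ^ 2 ∧ q ^ 2 = b ^ 2 - 4 * z ^ 2 ∧
      r ^ 2 = c ^ 2 - 4 * z ^ 2 ∧ p * q = 2 * z * c - a * b ∧ p * r = 2 * z * b - a * c ∧
      q * r = 2 * z * a - b * c ∧ a * r + c * p + 2 * z * q = 0 ∧ a * q + b * p + 2 * z * r = 0 ∧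
      c * q + b * r + 2 * z * p = 0 := by
  by_cases ha : a ^ 2 - 4 * z ^ 2 = 0
  · by_cases hb : b ^ 2 - 4 * z ^ 2 = 0
    · by_cases hc : c ^ 2 - 4 * z ^ 2 = 0
      · have sq : ∀ t : ℂ, t ^ 2 = 0 → 0 * 0 = t := fun t ht => by
          rw [pow_eq_zero_iff two_ne_zero |>.1 ht, mul_zero]
        refine ⟨0, 0, 0, by simp [ha], by simp [hb], by simp [hc], sq _ ?_, sq _ ?_, sq _ ?_,
          by simp, by simp, by simp⟩
        · linear_combination (b ^ 2 - 4 * z ^ 2) * ha - 4 * z * h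
        · linear_combination (c ^ 2 - 4 * z ^ 2) * ha - 4 * z * h
        · linear_combination (c ^ 2 - 4 * z ^ 2) * hb - 4 * z * h
      · obtain ⟨r, q, p, h1, h2, h3, h4, h5, h6, h7, h8, h9⟩ :=
          exists_antisymmetric_part_of_ne (z := z) (a := c) (b := b) (c := a) hc
            (by linear_combination h)
        refine ⟨p, q, r, h3, h2, h1, ?_, ?_, ?_, ?_, ?_, ?_⟩
        · linear_combination h6
        · linear_combination h5
        · linear_combination h4
        · linear_combination h7
        · linear_combination h9
        · linear_combination h8
    · obtain ⟨q, p, r, h1, h2, h3, h4, h5, h6, h7, h8, h9⟩ :=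
        exists_antisymmetric_part_of_ne (z := z) (a := b) (b := a) (c := c) hb
          (by linear_combination h)
      refine ⟨p, q, r, h2, h1, h3, ?_, ?_, ?_, ?_, ?_, ?_⟩
      · linear_combination h4
      · linear_combination h6
      · linear_combination h5
      · linear_combination h9
      · linear_combination h8
      · linear_combination h7
  · exact exists_antisymmetric_part_of_ne ha h

/-- A singular symmetric matrix with constant diagonal is the symmetric part of a matrix that
corresponds to a point of the sextic Del Pezzo surface. -/
theorem exists_delPezzoQuadrics {z a b c : ℂ}
    (h : 4 * z ^ 3 + a * b * c - z * (a ^ 2 + b ^ 2 + c ^ 2) = 0) :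
    ∃ x : Fin 7 → ℂ, DelPezzoQuadrics x ∧ x 6 = z ∧ x 0 + x 2 = a ∧ x 1 + x 4 = b ∧
      x 3 + x 5 = c ∧ (x 0 - x 2) ^ 2 = a ^ 2 - 4 * z ^ 2 ∧ (x 1 - x 4) ^ 2 = b ^ 2 - 4 * z ^ 2 ∧
      (x 3 - x 5) ^ 2 = c ^ 2 - 4 * z ^ 2 ∧
      (x 0 - x 2) * (x 1 - x 4) = a * b - 2 * z * c ∧
      (x 0 - x 2) * (x 3 - x 5) = 2 * z * b - a * c ∧
      (x 1 - x 4) * (x 3 - x 5) = b * c - 2 * z * a := by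
  obtain ⟨p, q, r, h1, h2, h3, h4, h5, h6, h7, h8, h9⟩ := exists_antisymmetric_part h
  refine ⟨![(a + p) / 2, (b - q) / 2, (a - p) / 2, (c + r) / 2, (b + q) / 2, (c - r) / 2, z],
    ⟨?_, ?_, ?_, ?_, ?_, ?_, ?_, ?_, ?_⟩, ?_, ?_, ?_, ?_, ?_, ?_, ?_, ?_, ?_, ?_⟩ <;>
    simp [Matrix.cons_val]
  · linear_combination -h1 / 4
  · linear_combination -h2 / 4
  · linear_combination -h3 / 4
  · linear_combination h5 / 4 - h7 / 4
  · linear_combination h5 / 4 + h7 / 4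
  · linear_combination h4 / 4 - h8 / 4
  · linear_combination h4 / 4 + h8 / 4
  · linear_combination h6 / 4 - h9 / 4
  · linear_combination h6 / 4 + h9 / 4
  · ring
  · ring
  · ring
  · linear_combination h1
  · linear_combination h2
  · linear_combination h3
  · linear_combination -h4
  · linear_combination h5
  · linear_combination -h6

theorem eq_or_eq_neg_of_products {ι : Type*} {a b : ι → ℂ} (h : ∀ i j, a i * a j = b i * b j) :
    a = b ∨ a = -b := by
  by_cases hb : b = 0
  · left
    funext i
    have := h i i
    simp only [hb, Pi.zero_apply, mul_zero, mul_self_eq_zero] at this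
    rw [this, hb, Pi.zero_apply]
  · obtain ⟨i, hi⟩ := Function.ne_iff.1 hb
    have hi : b i ≠ 0 := hi
    rcases mul_self_eq_mul_self_iff.1 (h i i) with h1 | h1
    · left
      funext j
      have := h i j
      rw [h1] at this
      exact mul_left_cancel₀ hi this
    · right
      funext j
      have := h i j
      rw [h1] at this
      refine mul_left_cancel₀ hi ?_
      simp only [Pi.neg_apply]
      linear_combination -this

/-- Equations of the threefold. -/
structure ThreefoldEquations (w : Fin 11 → ℂ) : Prop where
  -- The rows `w 0, …, w 3` and `w 4, …, w 7` are proportional, with ratio `y₀ ^ 2 : y₁ ^ 2`.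
  h01 : w 0 * w 5 = w 1 * w 4
  h02 : w 0 * w 6 = w 2 * w 4
  h03 : w 0 * w 7 = w 3 * w 4
  h12 : w 1 * w 6 = w 2 * w 5
  h13 : w 1 * w 7 = w 3 * w 5
  h23 : w 2 * w 7 = w 3 * w 6
  -- The products of the antisymmetric coordinates are, up to sign, the `2 × 2` minors of the
  -- symmetric part.
  h88 : w 8 * w 8 = w 1 * w 5 - 4 * (w 0 * w 4)
  h99 : w 9 * w 9 = w 2 * w 6 - 4 * (w 0 * w 4)
  hXX : w 10 * w 10 = w 3 * w 7 - 4 * (w 0 * w 4)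
  h89 : w 8 * w 9 = w 1 * w 6 - 2 * (w 0 * w 7)
  h8X : w 8 * w 10 = 2 * (w 0 * w 6) - w 1 * w 7
  h9X : w 9 * w 10 = w 2 * w 7 - 2 * (w 0 * w 5)
  -- Both determinants are needed, since either row may vanish.
  det : 4 * (w 0 * w 0 * w 0) + w 1 * w 2 * w 3 -
    (w 0 * w 1 * w 1 + w 0 * w 2 * w 2 + w 0 * w 3 * w 3) = 0
  det' : 4 * (w 4 * w 4 * w 4) + w 5 * w 6 * w 7 -
    (w 4 * w 5 * w 5 + w 4 * w 6 * w 6 + w 4 * w 7 * w 7) = 0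

theorem ThreefoldEquations.mk_mem {w : Fin 11 → ℂ} (h : ThreefoldEquations w) (hw : w ≠ 0) :
    Projectivization.mk ℂ w hw ∈ threefold := by
  obtain ⟨h01, h02, h03, h12, h13, h23, h88, h99, hXX, h89, h8X, h9X, det, det'⟩ := h
  obtain ⟨σ, α, β, hα, hβ, hdet⟩ : ∃ (σ : Fin 4 → ℂ) (α β : ℂ),
      ![w 0, w 1, w 2, w 3] = α ^ 2 • σ ∧ ![w 4, w 5, w 6, w 7] = β ^ 2 • σ ∧
        4 * σ 0 ^ 3 + σ 1 * σ 2 * σ 3 - σ 0 * (σ 1 ^ 2 + σ 2 ^ 2 + σ 3 ^ 2) = 0 := by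
    by_cases hS : ![w 0, w 1, w 2, w 3] = 0
    · refine ⟨![w 4, w 5, w 6, w 7], 0, 1, by simp [hS], by simp, ?_⟩
      simp [Matrix.cons_val]
      linear_combination det'
    · obtain ⟨c, hc⟩ := exists_smul_eq_of_minors (b := ![w 4, w 5, w 6, w 7]) hS (by
        intro i j
        fin_cases i <;> fin_cases j <;> simp [Matrix.cons_val] <;> grind)
      obtain ⟨β, rfl⟩ := IsAlgClosed.exists_pow_nat_eq c two_pos
      refine ⟨![w 0, w 1, w 2, w 3], 1, β, by simp, hc, ?_⟩
      simp [Matrix.cons_val]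
      linear_combination det
  obtain ⟨x, hx, hx6, hx1, hx2, hx3, e11, e22, e33, e12, e13, e23⟩ := exists_delPezzoQuadrics hdet
  have w0 : w 0 = α ^ 2 * σ 0 := by simpa using congrFun hα 0
  have w1 : w 1 = α ^ 2 * σ 1 := by simpa using congrFun hα 1
  have w2 : w 2 = α ^ 2 * σ 2 := by simpa using congrFun hα 2
  have w3 : w 3 = α ^ 2 * σ 3 := by simpa using congrFun hα 3
  have w4 : w 4 = β ^ 2 * σ 0 := by simpa using congrFun hβ 0
  have w5 : w 5 = β ^ 2 * σ 1 := by simpa using congrFun hβ 1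
  have w6 : w 6 = β ^ 2 * σ 2 := by simpa using congrFun hβ 2
  have w7 : w 7 = β ^ 2 * σ 3 := by simpa using congrFun hβ 3
  rw [w0, w1, w4, w5] at h88
  rw [w0, w2, w4, w6] at h99
  rw [w0, w3, w4, w7] at hXX
  rw [w0, w1, w6, w7] at h89
  rw [w0, w1, w6, w7] at h8X
  rw [w0, w2, w5, w7] at h9X
  -- The products determine `(w 8, w 9, w 10)` only up to a common sign; replacing `β` by `-β`
  -- absorbs it without changing the other coordinates.
  obtain ⟨γ, hγ, h8, h9, hX⟩ : ∃ γ, γ ^ 2 = β ^ 2 ∧ w 8 = α * γ * (x 0 - x 2) ∧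
      w 9 = α * γ * (x 1 - x 4) ∧ w 10 = α * γ * (x 3 - x 5) := by
    have := eq_or_eq_neg_of_products (a := ![w 8, w 9, w 10])
      (b := (α * β) • ![x 0 - x 2, x 1 - x 4, x 3 - x 5]) (by
        intro i j
        fin_cases i <;> fin_cases j <;> simp [Matrix.cons_val]
        · linear_combination h88 - (α * β) ^ 2 * e11
        · linear_combination h89 - (α * β) ^ 2 * e12
        · linear_combination h8X - (α * β) ^ 2 * e13
        · linear_combination h89 - (α * β) ^ 2 * e12
        · linear_combination h99 - (α * β) ^ 2 * e22
        · linear_combination h9X - (α * β) ^ 2 * e23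
        · linear_combination h8X - (α * β) ^ 2 * e13
        · linear_combination h9X - (α * β) ^ 2 * e23
        · linear_combination hXX - (α * β) ^ 2 * e33)
    rcases this with h | h
    · refine ⟨β, rfl, ?_, ?_, ?_⟩
      · simpa using congrFun h 0
      · simpa using congrFun h 1
      · simpa using congrFun h 2
    · refine ⟨-β, by ring, ?_, ?_, ?_⟩
      · have := congrFun h 0
        simp at this
        linear_combination this
      · have := congrFun h 1
        simp at this
        linear_combination this
      · have := congrFun h 2
        simp [Matrix.cons_val] at this
        linear_combination this
  have hq : quotientMap ![α, γ] x = w := by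
    funext i
    fin_cases i <;> simp [quotientMap, Matrix.cons_val, *]
  have hq0 : quotientMap ![α, γ] x ≠ 0 := hq ▸ hw
  have hx0 : x ≠ 0 := by
    rintro rfl
    exact hq0 (by funext i; fin_cases i <;> simp [quotientMap])
  refine ⟨![α, γ], x, ?_, hx0, hq0, hx.mk_mem hx0, by simp only [hq]⟩
  intro h0
  have hα0 : α = 0 := congrFun h0 0
  have hγ0 : γ = 0 := congrFun h0 1
  exact hq0 (by funext i; fin_cases i <;> simp [quotientMap, hα0, hγ0])

/-! ### The sextics in coordinates adapted to the tetrahedron -/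

/-- The linear combinations of the eleven sextic monomials in the coordinates of `ℙ³` and their
sum `t₁ + t₂ + t₃` that give the coordinates of the threefold. -/
def recombine {R : Type*} [CommRing R] (f : Fin 11 → R) : Fin 11 → R :=
  ![-f 0 + f 1 + f 2 + f 3, 2 * (f 0 + f 1 + f 2 - f 3), 2 * (f 0 - f 1 + f 2 + f 3),
    2 * (-f 0 - f 1 + f 2 - f 3), f 7 - f 8 - f 9 - f 10, -2 * (f 7 + f 8 + f 9 - f 10),
    -2 * (f 7 - f 8 + f 9 + f 10), -2 * (-f 7 - f 8 + f 9 - f 10), 4 * (f 4 + f 5),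
    -4 * (f 5 + f 6), -4 * (f 4 + f 6)]

/-- The exponents of `t₀`, `t₁ + t₂ + t₃`, `t₁`, `t₂`, `t₃` in the eleven sextics. -/
def sexticExponent : Fin 11 → Fin 5 → ℕ :=
  ![![2, 1, 1, 1, 1], ![2, 2, 0, 1, 1], ![2, 2, 1, 0, 1], ![2, 2, 1, 1, 0],
    ![1, 1, 2, 1, 1], ![1, 1, 1, 2, 1], ![1, 1, 1, 1, 2],
    ![0, 0, 2, 2, 2], ![0, 1, 1, 2, 2], ![0, 1, 2, 1, 2], ![0, 1, 2, 2, 1]]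

/-- The equation of the plane that cuts the faces of the tetrahedron in the double lines. -/
noncomputable def planeForm : MvPolynomial (Fin 4) ℂ := X 1 + X 2 + X 3

/-- Eleven sextics that span the linear system. -/
noncomputable def sexticGenerator (k : Fin 11) : MvPolynomial (Fin 4) ℂ :=
  X 0 ^ sexticExponent k 0 * planeForm ^ sexticExponent k 1 * X 1 ^ sexticExponent k 2 *
    X 2 ^ sexticExponent k 3 * X 3 ^ sexticExponent k 4

/-- The sextics that give the parametrization of the threefold. -/
noncomputable def threefoldForm : Fin 11 → MvPolynomial (Fin 4) ℂ := recombine sexticGenerator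

theorem map_recombine {R S : Type*} [CommRing R] [CommRing S] (φ : R →+* S) (f : Fin 11 → R)
    (i : Fin 11) : φ (recombine f i) = recombine (fun k => φ (f k)) i := by
  have h2 : φ 2 = 2 := map_ofNat φ 2
  have h4 : φ 4 = 4 := map_ofNat φ 4
  fin_cases i <;> simp [recombine, h2, h4]

theorem planeForm_isHomogeneous : planeForm.IsHomogeneous 1 :=
  ((isHomogeneous_X _ _).add (isHomogeneous_X _ _)).add (isHomogeneous_X _ _)

theorem sexticGenerator_isHomogeneous (k : Fin 11) : (sexticGenerator k).IsHomogeneous 6 := by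
  have h := ((((isHomogeneous_X_pow (R := ℂ) (0 : Fin 4) (sexticExponent k 0)).mul
    (planeForm_isHomogeneous.pow (sexticExponent k 1))).mul
    (isHomogeneous_X_pow 1 (sexticExponent k 2))).mul
    (isHomogeneous_X_pow 2 (sexticExponent k 3))).mul
    (isHomogeneous_X_pow 3 (sexticExponent k 4))
  have hk : sexticExponent k 0 + 1 * sexticExponent k 1 + sexticExponent k 2 +
      sexticExponent k 3 + sexticExponent k 4 = 6 := by
    fin_cases k <;> rfl
  rwa [hk] at h

theorem recombine_mem {R M : Type*} [CommRing R] [CommRing M] [Algebra R M] (S : Submodule R M)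
    {f : Fin 11 → M} (hf : ∀ k, f k ∈ S) (i : Fin 11) : recombine f i ∈ S := by
  have h2 : ∀ x ∈ S, 2 * x ∈ S := fun x hx => by
    rw [two_mul]
    exact S.add_mem hx hx
  have hm2 : ∀ x ∈ S, -2 * x ∈ S := fun x hx => by
    rw [neg_mul]
    exact S.neg_mem (h2 x hx)
  have h4 : ∀ x ∈ S, 4 * x ∈ S := fun x hx => by
    have := h2 _ (h2 x hx)
    rwa [← mul_assoc, show (2 : M) * 2 = 4 by norm_num] at this
  have hm4 : ∀ x ∈ S, -4 * x ∈ S := fun x hx => by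
    rw [neg_mul]
    exact S.neg_mem (h4 x hx)
  fin_cases i
  · exact S.add_mem (S.add_mem (S.add_mem (S.neg_mem (hf 0)) (hf 1)) (hf 2)) (hf 3)
  · exact h2 _ (S.sub_mem (S.add_mem (S.add_mem (hf 0) (hf 1)) (hf 2)) (hf 3))
  · exact h2 _ (S.add_mem (S.add_mem (S.sub_mem (hf 0) (hf 1)) (hf 2)) (hf 3))
  · exact h2 _ (S.sub_mem (S.add_mem (S.sub_mem (S.neg_mem (hf 0)) (hf 1)) (hf 2)) (hf 3))
  · exact S.sub_mem (S.sub_mem (S.sub_mem (hf 7) (hf 8)) (hf 9)) (hf 10)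
  · exact hm2 _ (S.sub_mem (S.add_mem (S.add_mem (hf 7) (hf 8)) (hf 9)) (hf 10))
  · exact hm2 _ (S.add_mem (S.add_mem (S.sub_mem (hf 7) (hf 8)) (hf 9)) (hf 10))
  · exact hm2 _ (S.sub_mem (S.add_mem (S.sub_mem (S.neg_mem (hf 7)) (hf 8)) (hf 9)) (hf 10))
  · exact h4 _ (S.add_mem (hf 4) (hf 5))
  · exact hm4 _ (S.add_mem (hf 5) (hf 6))
  · exact hm4 _ (S.add_mem (hf 4) (hf 6))

theorem threefoldForm_isHomogeneous (i : Fin 11) : (threefoldForm i).IsHomogeneous 6 :=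
  recombine_mem (homogeneousSubmodule (Fin 4) ℂ 6) sexticGenerator_isHomogeneous i

/-- The values of the eleven sextics. -/
def sexticValue (t₀ l t₁ t₂ t₃ : ℂ) : Fin 11 → ℂ :=
  ![t₀ ^ 2 * l * t₁ * t₂ * t₃, t₀ ^ 2 * l ^ 2 * t₂ * t₃, t₀ ^ 2 * l ^ 2 * t₁ * t₃,
    t₀ ^ 2 * l ^ 2 * t₁ * t₂, t₀ * l * t₁ ^ 2 * t₂ * t₃, t₀ * l * t₁ * t₂ ^ 2 * t₃,
    t₀ * l * t₁ * t₂ * t₃ ^ 2, t₁ ^ 2 * t₂ ^ 2 * t₃ ^ 2, l * t₁ * t₂ ^ 2 * t₃ ^ 2,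
    l * t₁ ^ 2 * t₂ * t₃ ^ 2, l * t₁ ^ 2 * t₂ ^ 2 * t₃]

theorem eval_sexticGenerator (t : Fin 4 → ℂ) (k : Fin 11) :
    eval t (sexticGenerator k) = sexticValue (t 0) (t 1 + t 2 + t 3) (t 1) (t 2) (t 3) k := by
  fin_cases k <;> simp [sexticGenerator, sexticExponent, sexticValue, planeForm]

theorem polyMap_threefoldForm (t : Fin 4 → ℂ) :
    polyMap threefoldForm t =
      recombine (sexticValue (t 0) (t 1 + t 2 + t 3) (t 1) (t 2) (t 3)) := by
  funext i
  simp only [polyMap, threefoldForm, map_recombine, eval_sexticGenerator]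

/-- The first four coordinates are `t₀ ^ 2 * l`, and the next four `-t₁ * t₂ * t₃`, times the same
four cubics in `t₁, t₂, t₃`, which satisfy the determinantal equation. -/
theorem threefoldEquations_recombine (t₀ t₁ t₂ t₃ : ℂ) :
    ThreefoldEquations (recombine (sexticValue t₀ (t₁ + t₂ + t₃) t₁ t₂ t₃)) := by
  constructor <;> simp only [recombine, sexticValue, Matrix.cons_val] <;> ring

/-- Each equation is homogeneous, so it passes from the values of `f` to their Zariski closure. -/
theorem ThreefoldEquations.of_mem_ratImage {n : ℕ} {f : (Fin (n + 1) → ℂ) → (Fin 11 → ℂ)}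
    (hf : ∀ t, ThreefoldEquations (f t)) {w : Fin 11 → ℂ} {hw : w ≠ 0}
    (h : Projectivization.mk ℂ w hw ∈ ratImage (m := 10) f) : ThreefoldEquations w := by
  rw [mk_mem_ratImage] at h
  have h2 : ∀ i j : Fin 11, (X i * X j : MvPolynomial (Fin 11) ℂ).IsHomogeneous 2 := fun i j =>
    (isHomogeneous_X _ _).mul (isHomogeneous_X _ _)
  have h3 : ∀ i j k : Fin 11, (X i * X j * X k : MvPolynomial (Fin 11) ℂ).IsHomogeneous 3 :=
    fun i j k => (h2 i j).mul (isHomogeneous_X _ _)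
  have key : ∀ (d : ℕ) (G : MvPolynomial (Fin 11) ℂ), G.IsHomogeneous d →
      (∀ t, eval (f t) G = 0) → eval w G = 0 := fun d G hG h0 => h d G hG fun t _ _ => h0 t
  have minor : ∀ i j k l : Fin 11, (∀ t, f t i * f t j = f t k * f t l) → w i * w j = w k * w l :=
    fun i j k l h0 => by
      have := key 2 (X i * X j - X k * X l) ((h2 _ _).sub (h2 _ _)) fun t => by simp [h0]
      simpa [sub_eq_zero] using this
  have square : ∀ i j k l : Fin 11,
      (∀ t, f t i * f t i = f t j * f t k - 4 * (f t 0 * f t l)) →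
        w i * w i = w j * w k - 4 * (w 0 * w l) := fun i j k l h0 => by
    have := key 2 (X i * X i - (X j * X k - C 4 * (X 0 * X l)))
      ((h2 _ _).sub ((h2 _ _).sub ((h2 _ _).C_mul _))) fun t => by simp [h0]
    simpa [sub_eq_zero] using this
  have det : ∀ i j k l : Fin 11, (∀ t, 4 * (f t i * f t i * f t i) + f t j * f t k * f t l -
      (f t i * f t j * f t j + f t i * f t k * f t k + f t i * f t l * f t l) = 0) →
        4 * (w i * w i * w i) + w j * w k * w l -
          (w i * w j * w j + w i * w k * w k + w i * w l * w l) = 0 := fun i j k l h0 => by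
    have := key 3 (C 4 * (X i * X i * X i) + X j * X k * X l -
      (X i * X j * X j + X i * X k * X k + X i * X l * X l))
      ((((h3 _ _ _).C_mul _).add (h3 _ _ _)).sub (((h3 _ _ _).add (h3 _ _ _)).add (h3 _ _ _)))
      fun t => by simpa using h0 t
    simpa using this
  refine ⟨minor _ _ _ _ fun t => (hf t).h01, minor _ _ _ _ fun t => (hf t).h02,
    minor _ _ _ _ fun t => (hf t).h03, minor _ _ _ _ fun t => (hf t).h12,
    minor _ _ _ _ fun t => (hf t).h13, minor _ _ _ _ fun t => (hf t).h23,
    square _ _ _ _ fun t => (hf t).h88, square _ _ _ _ fun t => (hf t).h99,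
    square _ _ _ _ fun t => (hf t).hXX, ?_, ?_, ?_, det _ _ _ _ fun t => (hf t).det,
    det _ _ _ _ fun t => (hf t).det'⟩
  · have := key 2 (X 8 * X 9 - (X 1 * X 6 - C 2 * (X 0 * X 7)))
      ((h2 _ _).sub ((h2 _ _).sub ((h2 _ _).C_mul _))) fun t => by simp [(hf t).h89]
    simpa [sub_eq_zero] using this
  · have := key 2 (X 8 * X 10 - (C 2 * (X 0 * X 6) - X 1 * X 7))
      ((h2 _ _).sub (((h2 _ _).C_mul _).sub (h2 _ _))) fun t => by simp [(hf t).h8X]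
    simpa [sub_eq_zero] using this
  · have := key 2 (X 9 * X 10 - (X 2 * X 7 - C 2 * (X 0 * X 5)))
      ((h2 _ _).sub ((h2 _ _).sub ((h2 _ _).C_mul _))) fun t => by simp [(hf t).h9X]
    simpa [sub_eq_zero] using this

/-- The factor by which the sextics differ from the coordinates of the threefold. -/
def commonFactor {R : Type*} [CommRing R] (y₁ u₀ u₁ u₂ : R) : R :=
  y₁ ^ 4 * ((u₁ + u₂) * (u₁ - u₂) * (u₁ + u₀) * (u₁ - u₀) * (u₂ + u₀) * (u₂ - u₀)) ^ 2 *
    ((u₁ - u₀) * (u₂ - u₀) * (u₁ + u₂))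

/-- The preimage `t` is `tetrahedralProjection` of the point of the threefold, divided by the common
factor `y₀`. -/
theorem sexticValue_quotient (y₀ y₁ u₀ u₁ u₂ : ℂ) :
    ∃ t : Fin 4 → ℂ, recombine (sexticValue (t 0) (t 1 + t 2 + t 3) (t 1) (t 2) (t 3)) =
      (-8 * commonFactor y₁ u₀ u₁ u₂) • quotientMap ![y₀, y₁] (cubicMap ![u₀, u₁, u₂]) := by
  -- All entries factor into these six linear forms; as opaque atoms they keep the polynomial
  -- identities small. The sum `t 1 + t 2 + t 3` factors as well, by `hl`.
  obtain ⟨A, hA⟩ : ∃ A, A = u₁ + u₀ := ⟨_, rfl⟩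
  obtain ⟨A', hA'⟩ : ∃ A', A' = u₁ - u₀ := ⟨_, rfl⟩
  obtain ⟨B, hB⟩ : ∃ B, B = u₂ + u₀ := ⟨_, rfl⟩
  obtain ⟨B', hB'⟩ : ∃ B', B' = u₂ - u₀ := ⟨_, rfl⟩
  obtain ⟨C, hC⟩ : ∃ C, C = u₁ + u₂ := ⟨_, rfl⟩
  obtain ⟨C', hC'⟩ : ∃ C', C' = u₁ - u₂ := ⟨_, rfl⟩
  have hl : y₁ * (C * A' * B) + y₁ * (C' * A' * B') + -(y₁ * (C * A * B')) = y₁ * (C' * A * B) := by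
    subst_vars
    ring
  obtain ⟨K, hK⟩ : ∃ K, K = commonFactor y₁ u₀ u₁ u₂ := ⟨_, rfl⟩
  have hK' : K = y₁ ^ 4 * (C * C' * A * A' * B * B') ^ 2 * (A' * B' * C) := by
    subst_vars
    rfl
  refine ⟨![y₀ * (A' * B' * C), y₁ * (C * A' * B), y₁ * (C' * A' * B'), -(y₁ * (C * A * B'))], ?_⟩
  have hv : sexticValue (y₀ * (A' * B' * C)) (y₁ * (C' * A * B)) (y₁ * (C * A' * B))
      (y₁ * (C' * A' * B')) (-(y₁ * (C * A * B'))) = K •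
        ![-(y₀ ^ 2 * (A' * B' * C)), -(y₀ ^ 2 * (C' * A * B')), -(y₀ ^ 2 * (C * A * B)),
          y₀ ^ 2 * (C' * A' * B), -(y₀ * y₁ * (C * A' * B)), -(y₀ * y₁ * (C' * A' * B')),
          y₀ * y₁ * (C * A * B'), y₁ ^ 2 * (A' * B' * C), y₁ ^ 2 * (C' * A * B'),
          y₁ ^ 2 * (C * A * B), -(y₁ ^ 2 * (C' * A' * B))] := by
    rw [hK']
    funext k
    fin_cases k <;> simp [sexticValue, Matrix.cons_val] <;> ring
  simp only [Matrix.cons_val_zero, Matrix.cons_val_one, Matrix.cons_val, hl]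
  rw [hv, ← hK]
  subst hA hA' hB hB' hC hC'
  clear hK hK' hv hl
  funext i
  fin_cases i <;> simp [recombine, quotientMap, cubicMap, Matrix.cons_val] <;> ring

/-- The coordinates of `ℙ¹⁰`, evaluated on `ℙ¹ × S₆`, as a linear map in the point of `S₆`. -/
def quotientLinearMap (y : Fin 2 → ℂ) : (Fin 7 → ℂ) →ₗ[ℂ] (Fin 11 → ℂ) where
  toFun := quotientMap y
  map_add' a b := by
    funext i
    fin_cases i <;> simp [quotientMap] <;> ring
  map_smul' c a := by
    funext i
    fin_cases i <;> simp [quotientMap] <;> ring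

/-- Where `commonFactor` is nonzero, the point is a nonzero multiple of a value of the sextics, so
the pullback of `G` to the five variables `y, u` vanishes there and hence identically. -/
theorem eval_quotientMap_cubicMap {d : ℕ} {G : MvPolynomial (Fin 11) ℂ} (hG : G.IsHomogeneous d)
    (h : ∀ t, t ≠ 0 → polyMap threefoldForm t ≠ 0 → eval (polyMap threefoldForm t) G = 0)
    (y : Fin 2 → ℂ) (u : Fin 3 → ℂ) : eval (quotientMap y (cubicMap u)) G = 0 := by
  let P : Fin 11 → MvPolynomial (Fin 5) ℂ :=
    ![X 0 ^ 2 * (X 2 * X 3 * X 4), X 0 ^ 2 * (X 3 ^ 2 * X 4 + X 2 ^ 2 * X 4),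
      X 0 ^ 2 * (X 3 * X 4 ^ 2 + X 2 ^ 2 * X 3), X 0 ^ 2 * (X 2 * X 4 ^ 2 + X 2 * X 3 ^ 2),
      X 1 ^ 2 * (X 2 * X 3 * X 4), X 1 ^ 2 * (X 3 ^ 2 * X 4 + X 2 ^ 2 * X 4),
      X 1 ^ 2 * (X 3 * X 4 ^ 2 + X 2 ^ 2 * X 3), X 1 ^ 2 * (X 2 * X 4 ^ 2 + X 2 * X 3 ^ 2),
      X 0 * X 1 * (X 3 ^ 2 * X 4 - X 2 ^ 2 * X 4),
      X 0 * X 1 * (X 3 * X 4 ^ 2 - X 2 ^ 2 * X 3), X 0 * X 1 * (X 2 * X 4 ^ 2 - X 2 * X 3 ^ 2)]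
  have hP : ∀ s : Fin 5 → ℂ, polyMap P s = quotientMap ![s 0, s 1] (cubicMap ![s 2, s 3, s 4]) := by
    intro s
    funext i
    fin_cases i <;> simp [P, polyMap, quotientMap, cubicMap, Matrix.cons_val]
  let δ : MvPolynomial (Fin 5) ℂ := commonFactor (X 1) (X 2) (X 3) (X 4)
  have hδ : ∀ s : Fin 5 → ℂ, eval s δ = commonFactor (s 1) (s 2) (s 3) (s 4) := by
    intro s
    simp [δ, commonFactor]
  have hδ0 : δ ≠ 0 := by
    intro h0
    have := congrArg (eval ![0, 1, 0, 1, 2]) h0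
    rw [hδ] at this
    simp only [Matrix.cons_val] at this
    norm_num [commonFactor] at this
  have hzero : bind₁ P G = 0 := by
    refine eq_zero_of_eval_mul hδ0 fun s hs => ?_
    rw [hδ] at hs
    rw [eval_bind₁_eq, hP]
    obtain ⟨t, ht⟩ := sexticValue_quotient (s 0) (s 1) (s 2) (s 3) (s 4)
    rw [← polyMap_threefoldForm] at ht
    have hq : quotientMap ![s 0, s 1] (cubicMap ![s 2, s 3, s 4]) ≠ 0 := by
      intro h0
      apply hs
      have h4 := congrFun h0 4
      have h5 := congrFun h0 5
      have h6 := congrFun h0 6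
      have h7 := congrFun h0 7
      simp only [quotientMap, cubicMap, Matrix.cons_val, Pi.zero_apply] at h4 h5 h6 h7
      rw [commonFactor]
      -- The combination `w 5 + w 6 - w 7 - 2 * w 4` equals `y₁² (u₁ - u₀)(u₂ - u₀)(u₁ + u₂)`, a
      -- factor of `commonFactor`.
      linear_combination
        (s 1 ^ 2 * ((s 3 + s 4) * (s 3 - s 4) * (s 3 + s 2) * (s 3 - s 2) * (s 4 + s 2) *
          (s 4 - s 2)) ^ 2) * (h5 + h6 - h7 - 2 * h4)
    have hf : polyMap threefoldForm t ≠ 0 := by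
      rw [ht]
      exact smul_ne_zero (mul_ne_zero (by norm_num) hs) hq
    have ht0 : t ≠ 0 := by
      rintro rfl
      apply hf
      funext i
      exact eval_zero_of_isHomogeneous (threefoldForm_isHomogeneous i) (by norm_num)
    have := h t ht0 hf
    rw [ht, eval_smul_of_isHomogeneous hG] at this
    exact (mul_eq_zero.1 this).resolve_left
      (pow_ne_zero _ (mul_ne_zero (by norm_num) hs))
  have := congrArg (eval ![y 0, y 1, u 0, u 1, u 2]) hzero
  rw [eval_bind₁_eq, hP, map_zero] at this
  have hy : ![y 0, y 1] = y := by funext i; fin_cases i <;> rfl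
  have hu : ![u 0, u 1, u 2] = u := by funext i; fin_cases i <;> rfl
  simpa only [Matrix.cons_val, hy, hu] using this

theorem ratImage_threefoldForm :
    ratImage (n := 3) (m := 10) (polyMap threefoldForm) = threefold := by
  refine Set.Subset.antisymm ?_ ?_
  · intro p
    induction p using Projectivization.ind with | _ w hw => ?_
    intro hp
    exact (ThreefoldEquations.of_mem_ratImage (fun t => by
      rw [polyMap_threefoldForm]
      exact threefoldEquations_recombine _ _ _ _) hp).mk_mem hw
  · rintro _ ⟨y, x, -, hx, hw, hxS, rfl⟩
    refine mk_mem_ratImage.2 fun d G hG hA => ?_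
    -- For fixed `y` the coordinates are linear in `x`, so `G` pulls back to a form on `ℙ⁶`. It
    -- vanishes on the image of `cubicMap`, hence on the closure `S₆`.
    have h := mk_mem_ratImage.1 hxS d (linSubst (quotientLinearMap y) G)
      (IsHomogeneous.linSubst _ hG) fun u _ _ => by
        rw [eval_linSubst]
        exact eval_quotientMap_cubicMap hG hA y u
    rwa [eval_linSubst] at h

/-! ### The projection to `ℙ³` -/

/-- The linear projection that inverts the parametrization of the threefold. -/
def tetrahedralProjection : (Fin 11 → ℂ) →ₗ[ℂ] (Fin 4 → ℂ) where
  toFun w := ![w 1 + w 2 - w 3 - 2 * w 0, w 8 + w 9 - w 10, w 8 - w 9 + w 10, -(w 8 + w 9 + w 10)]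
  map_add' a b := by
    funext i
    fin_cases i <;> simp <;> ring
  map_smul' c a := by
    funext i
    fin_cases i <;> simp <;> ring

/-- The factor by which the parametrization, followed by the projection, differs from the
identity. -/
noncomputable def projectionFactor : MvPolynomial (Fin 4) ℂ :=
  C 8 * (X 0 * planeForm * X 1 * X 2 * X 3)

theorem projectionFactor_isHomogeneous : projectionFactor.IsHomogeneous 5 :=
  (((((isHomogeneous_X _ _).mul planeForm_isHomogeneous).mul (isHomogeneous_X _ _)).mul
    (isHomogeneous_X _ _)).mul (isHomogeneous_X _ _)).C_mul 8

theorem projectionFactor_ne_zero : projectionFactor ≠ 0 := by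
  intro h
  have := congrArg (eval 1) h
  norm_num [projectionFactor, planeForm] at this

theorem tetrahedralProjection_polyMap (t : Fin 4 → ℂ) :
    tetrahedralProjection (polyMap threefoldForm t) = eval t projectionFactor • t := by
  rw [polyMap_threefoldForm]
  funext i
  fin_cases i <;> simp [tetrahedralProjection, recombine, sexticValue, Matrix.cons_val,
    projectionFactor, planeForm] <;> ring

theorem ker_tetrahedralProjection : LinearMap.ker tetrahedralProjection = projectionCentre := by
  refine le_antisymm ?_ ?_
  · intro w hw
    rw [LinearMap.mem_ker] at hw
    have e0 : w 1 + w 2 - w 3 - 2 * w 0 = 0 := congrFun hw 0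
    have e1 : w 8 + w 9 - w 10 = 0 := congrFun hw 1
    have e2 : w 8 - w 9 + w 10 = 0 := congrFun hw 2
    have e3 : -(w 8 + w 9 + w 10) = 0 := congrFun hw 3
    have h8 : w 8 = 0 := by linear_combination (e1 + e2) / 2
    have h9 : w 9 = 0 := by linear_combination -(e2 + e3) / 2
    have h10 : w 10 = 0 := by linear_combination -(e1 + e3) / 2
    -- The sign matrix of the four `Pᵢ` is orthogonal up to scaling, which gives their coefficients.
    -- Those of the three `Pᵢ'` are solved from `w 0, w 1, w 2`, and `e0` then accounts for `w 3`.
    have hw' : w = ((2 * w 4 + w 5 + w 6 + w 7) / 8) • pointP 0 +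
        ((2 * w 4 + w 5 - w 6 - w 7) / 8) • pointP 1 +
        ((2 * w 4 - w 5 + w 6 - w 7) / 8) • pointP 2 +
        ((2 * w 4 - w 5 - w 6 + w 7) / 8) • pointP 3 +
        ((w 1 + w 2) / 4) • pointP' 0 + ((2 * w 0 - w 2) / 4) • pointP' 1 +
        ((2 * w 0 - w 1) / 4) • pointP' 2 := by
      funext i
      fin_cases i <;>
        simp [pointP, pointP', quotientMap, delPezzoFixed, Matrix.cons_val, h8, h9, h10]
      · ring
      · ring
      · ring
      · linear_combination -e0
      · ring
      · ring
      · ring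
      · ring
    rw [hw', projectionCentre]
    refine add_mem (add_mem (add_mem (add_mem (add_mem (add_mem ?_ ?_) ?_) ?_) ?_) ?_) ?_ <;>
      exact Submodule.smul_mem _ _ (Submodule.subset_span (by simp))
  · rw [projectionCentre, Submodule.span_le]
    rintro w hw
    simp only [Set.mem_insert_iff, Set.mem_singleton_iff] at hw
    rw [SetLike.mem_coe, LinearMap.mem_ker]
    rcases hw with rfl | rfl | rfl | rfl | rfl | rfl | rfl <;> funext i <;> fin_cases i <;>
      simp [tetrahedralProjection, pointP, pointP', quotientMap, delPezzoFixed,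
        Matrix.cons_val] <;> norm_num

/-! ### Multiplicities -/

/-- The translation of a polynomial that moves the point `a` to the origin. -/
noncomputable def translate {n : ℕ} (a : Fin n → ℂ) :
    MvPolynomial (Fin n) ℂ →ₐ[ℂ] MvPolynomial (Fin n) ℂ :=
  aeval fun i => X i + C (a i)

/-- As membership in a power of the ideal of the origin, multiplicity is compatible with products,
powers and substitutions. -/
theorem multAt_iff {n m : ℕ} {F : MvPolynomial (Fin n) ℂ} {a : Fin n → ℂ} :
    MultAt F a m ↔ translate a F ∈ idealOfVars (Fin n) ℂ ^ m :=
  (mem_pow_idealOfVars_iff' _ _).symm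

theorem eval_translate {n : ℕ} (a z : Fin n → ℂ) (F : MvPolynomial (Fin n) ℂ) :
    eval z (translate a F) = eval (z + a) F := by
  have h : (aeval z : MvPolynomial (Fin n) ℂ →ₐ[ℂ] ℂ).comp (translate a) = aeval (z + a) := by
    ext i
    simp [translate]
  simpa [aeval_eq_eval] using DFunLike.congr_fun h F

theorem MultAt.mono {n m k : ℕ} {F : MvPolynomial (Fin n) ℂ} {a : Fin n → ℂ} (h : MultAt F a m)
    (hk : k ≤ m) : MultAt F a k :=
  fun e he => h e (he.trans_le hk)

theorem MultAt.mul {n m k : ℕ} {F G : MvPolynomial (Fin n) ℂ} {a : Fin n → ℂ} (hF : MultAt F a m)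
    (hG : MultAt G a k) : MultAt (F * G) a (m + k) := by
  rw [multAt_iff] at *
  rw [map_mul, pow_add]
  exact Ideal.mul_mem_mul hF hG

theorem MultAt.pow {n m : ℕ} {F : MvPolynomial (Fin n) ℂ} {a : Fin n → ℂ} (hF : MultAt F a m)
    (k : ℕ) : MultAt (F ^ k) a (m * k) := by
  rw [multAt_iff] at *
  rw [map_pow, pow_mul]
  exact Ideal.pow_mem_pow hF k

theorem multAt_one {n : ℕ} {F : MvPolynomial (Fin n) ℂ} {a : Fin n → ℂ} (h : eval a F = 0) :
    MultAt F a 1 := by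
  intro e he
  have he : e = 0 := (Finsupp.degree_eq_zero_iff e).1 (by omega)
  have h0 := eval_translate a 0 F
  rw [zero_add, h] at h0
  rw [he]
  change constantCoeff (translate a F) = 0
  rwa [eval_zero] at h0

/-- Substitution intertwines the translations by `a` and `ρ a`, and linear forms have no constant
term, so it maps the ideal of the origin into itself. -/
theorem MultAt.linSubst {k l m : ℕ} (ρ : (Fin l → ℂ) →ₗ[ℂ] (Fin k → ℂ))
    {F : MvPolynomial (Fin k) ℂ} {a : Fin l → ℂ} (h : MultAt F (ρ a) m) :
    MultAt (linSubst ρ F) a m := by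
  have hcomm : translate a (EnriquesFano.linSubst ρ F) =
      EnriquesFano.linSubst ρ (translate (ρ a) F) := by
    refine MvPolynomial.funext fun z => ?_
    rw [eval_translate, eval_linSubst, eval_linSubst, eval_translate, map_add]
  rw [multAt_iff] at *
  rw [hcomm]
  refine Ideal.pow_right_mono ?_ m (?_ : _ ∈
    (Ideal.map (EnriquesFano.linSubst ρ) (idealOfVars (Fin k) ℂ)) ^ m)
  · rw [idealOfVars, Ideal.map_span, Ideal.span_le]
    rintro _ ⟨_, ⟨i, rfl⟩, rfl⟩
    simp only [EnriquesFano.linSubst, aeval_X, SetLike.mem_coe]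
    exact Ideal.sum_mem _ fun j _ => Ideal.mul_mem_left _ _ (Ideal.subset_span ⟨j, rfl⟩)
  · rw [← Ideal.map_pow]
    exact Ideal.mem_map_of_mem _ h

theorem pderiv_translate {n : ℕ} (a : Fin n → ℂ) (i : Fin n) (F : MvPolynomial (Fin n) ℂ) :
    pderiv i (translate a F) = translate a (pderiv i F) := by
  induction F using MvPolynomial.induction_on with
  | C c => simp [translate]
  | add p q hp hq => simp [hp, hq]
  | mul_X p j hp =>
    have : pderiv i (translate a (X j)) = translate a (pderiv i (X j)) := by
      simp only [translate, aeval_X, map_add, pderiv_C, add_zero, pderiv_X]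
      by_cases hij : j = i
      · subst hij
        simp
      · simp [Pi.single_eq_of_ne hij]
    simp only [map_mul, Derivation.leibniz, map_add, smul_eq_mul, hp, this]

theorem MultAt.eval_pderiv {n : ℕ} {F : MvPolynomial (Fin n) ℂ} {a : Fin n → ℂ}
    (h : MultAt F a 2) (i : Fin n) : eval a (pderiv i F) = 0 := by
  have h1 := h (Finsupp.single i 1) (by simp)
  change coeff _ (translate a F) = 0 at h1
  have h2 := eval_translate a 0 (pderiv i F)
  rw [zero_add, ← pderiv_translate, eval_zero] at h2
  rw [← h2]
  change coeff 0 _ = 0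
  rw [coeff_pderiv]
  simp [h1]

/-- The degree in one coordinate is bounded by the multiplicity at the coordinate point. -/
theorem MultAt.add_le_of_mem_support {n d m : ℕ} {F : MvPolynomial (Fin n) ℂ}
    (hF : F.IsHomogeneous d) {i : Fin n} (h : MultAt F (Pi.single i 1) m) {e : Fin n →₀ ℕ}
    (he : e ∈ F.support) : e i + m ≤ d := by
  classical
  -- Dehomogenization at the `i`-th coordinate. It equals translation to the coordinate point
  -- followed by `χ`, so `ψ F` has no terms of degree below `m`.
  let ψ : MvPolynomial (Fin n) ℂ →ₐ[ℂ] MvPolynomial (Fin n) ℂ :=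
    aeval fun j => if j = i then 1 else X j
  let χ : MvPolynomial (Fin n) ℂ →ₐ[ℂ] MvPolynomial (Fin n) ℂ :=
    aeval fun j => if j = i then 0 else X j
  have hψ : ψ = χ.comp (translate (Pi.single i 1)) := by
    ext1 j
    by_cases hj : j = i
    · subst hj
      simp [ψ, χ, translate]
    · simp [ψ, χ, translate, hj]
  have hmem : ψ F ∈ idealOfVars (Fin n) ℂ ^ m := by
    rw [multAt_iff] at h
    rw [hψ, AlgHom.comp_apply]
    refine Ideal.pow_right_mono ?_ m (?_ : _ ∈ (Ideal.map χ (idealOfVars (Fin n) ℂ)) ^ m)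
    · rw [idealOfVars, Ideal.map_span, Ideal.span_le]
      rintro _ ⟨_, ⟨j, rfl⟩, rfl⟩
      simp only [χ, aeval_X, SetLike.mem_coe]
      split_ifs
      · exact zero_mem _
      · exact Ideal.subset_span ⟨j, rfl⟩
    · rw [← Ideal.map_pow]
      exact Ideal.mem_map_of_mem _ h
  have hmon : ∀ (e : Fin n →₀ ℕ) (c : ℂ), ψ (monomial e c) = monomial (e.erase i) c := by
    intro e c
    rw [monomial_eq, map_mul, monomial_eq]
    simp only [ψ, algHom_C, algebraMap_eq, Finsupp.prod, map_prod, map_pow, aeval_X]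
    congr 1
    rw [Finsupp.support_erase]
    by_cases hi : i ∈ e.support
    · rw [← Finset.mul_prod_erase _ _ hi, if_pos rfl, one_pow, one_mul]
      refine Finset.prod_congr rfl fun j hj => ?_
      have hj : j ≠ i := Finset.ne_of_mem_erase hj
      rw [if_neg hj, Finsupp.erase_ne hj]
    · rw [Finset.erase_eq_of_notMem hi]
      refine Finset.prod_congr rfl fun j hj => ?_
      have hj : j ≠ i := fun h => hi (h ▸ hj)
      rw [if_neg hj, Finsupp.erase_ne hj]
  have hdeg : ∀ e : Fin n →₀ ℕ, e.degree = e i + (e.erase i).degree := by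
    intro e
    conv_lhs => rw [← Finsupp.single_add_erase i e]
    simp [map_add]
  have hsupp : ∀ e ∈ F.support, e.degree = d := fun e he =>
    (hF.degree_eq_sum_deg_support he).symm
  -- Distinct monomials of `F` stay distinct, because homogeneity recovers the erased exponent.
  have hcoeff : coeff (e.erase i) (ψ F) = coeff e F := by
    conv_lhs => rw [F.as_sum, map_sum, coeff_sum]
    rw [Finset.sum_eq_single e]
    · rw [hmon, coeff_monomial, if_pos rfl]
    · intro e' he' hne
      rw [hmon, coeff_monomial, if_neg]
      intro heq
      apply hne
      have h1 := hdeg e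
      have h2 := hdeg e'
      rw [hsupp e he] at h1
      rw [hsupp e' he', heq] at h2
      rw [← Finsupp.single_add_erase i e', ← Finsupp.single_add_erase i e, heq,
        show e' i = e i by omega]
    · exact fun hn => absurd he hn
  have hle := (mem_pow_idealOfVars_iff m _).1 hmem (e.erase i) (by
    rw [mem_support_iff, hcoeff]
    exact mem_support_iff.1 he)
  have := hdeg e
  rw [hsupp e he] at this
  omega

/-! ### The linear system in adapted coordinates -/

theorem MultAt.zero {n : ℕ} (F : MvPolynomial (Fin n) ℂ) (a : Fin n → ℂ) : MultAt F a 0 :=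
  fun _ h => absurd h (Nat.not_lt_zero _)

/-- Multiplicities of the five linear factors add up, so each required multiplicity becomes a finite
inequality between exponents. -/
theorem sexticGenerator_multAt {t : Fin 4 → ℂ} {n : Fin 5 → ℕ} (h0 : MultAt (X 0) t (n 0))
    (hl : MultAt planeForm t (n 1)) (h1 : MultAt (X 1) t (n 2)) (h2 : MultAt (X 2) t (n 3))
    (h3 : MultAt (X 3) t (n 4)) (k : Fin 11) :
    MultAt (sexticGenerator k) t (n 0 * sexticExponent k 0 + n 1 * sexticExponent k 1 +
      n 2 * sexticExponent k 2 + n 3 * sexticExponent k 3 + n 4 * sexticExponent k 4) :=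
  ((((h0.pow _).mul (hl.pow _)).mul (h1.pow _)).mul (h2.pow _)).mul (h3.pow _)

theorem multAt_X {n : ℕ} {t : Fin n → ℂ} {i : Fin n} (h : t i = 0) :
    MultAt (X i : MvPolynomial (Fin n) ℂ) t 1 :=
  multAt_one (by rw [eval_X, h])

theorem sexticGenerator_multAt_apex {t : Fin 4 → ℂ} (ht : ∀ j, j ≠ 0 → t j = 0) (k : Fin 11) :
    MultAt (sexticGenerator k) t 4 := by
  have h1 := ht 1 (by decide)
  have h2 := ht 2 (by decide)
  have h3 := ht 3 (by decide)
  refine (sexticGenerator_multAt (n := ![0, 1, 1, 1, 1]) (MultAt.zero _ _)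
    (multAt_one (by simp [planeForm, h1, h2, h3])) (multAt_X h1) (multAt_X h2) (multAt_X h3)
    k).mono ?_
  revert k
  decide

theorem sexticGenerator_multAt_vertex {t : Fin 4 → ℂ} {i : Fin 4} (hi : i ≠ 0)
    (ht : ∀ j, j ≠ i → t j = 0) (k : Fin 11) : MultAt (sexticGenerator k) t 3 := by
  have hX : ∀ j, MultAt (X j : MvPolynomial (Fin 4) ℂ) t (if j = i then 0 else 1) := by
    intro j
    split_ifs with hj
    · exact MultAt.zero _ _
    · exact multAt_X (ht j hj)
  refine (sexticGenerator_multAt (n := ![if 0 = i then 0 else 1, 0, if 1 = i then 0 else 1,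
    if 2 = i then 0 else 1, if 3 = i then 0 else 1]) (hX 0) (MultAt.zero _ _) (hX 1) (hX 2) (hX 3)
    k).mono ?_
  clear hX ht t
  revert i k
  decide

theorem sexticGenerator_multAt_line {t : Fin 4 → ℂ} {i : Fin 4} (hi : i ≠ 0) (ht : t i = 0)
    (hl : t 1 + t 2 + t 3 = 0) (k : Fin 11) : MultAt (sexticGenerator k) t 2 := by
  have hX : ∀ j, MultAt (X j : MvPolynomial (Fin 4) ℂ) t (if j = i then 1 else 0) := by
    intro j
    split_ifs with hj
    · exact multAt_X (hj ▸ ht)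
    · exact MultAt.zero _ _
  refine (sexticGenerator_multAt (n := ![if 0 = i then 1 else 0, 1, if 1 = i then 1 else 0,
    if 2 = i then 1 else 0, if 3 = i then 1 else 0]) (hX 0)
    (multAt_one (by simpa [planeForm] using hl)) (hX 1) (hX 2) (hX 3) k).mono ?_
  clear hX ht hl t
  revert i k
  decide

/-- The exponents of the monomials of degree `6` that are of degree at most `2` in `t₀` and at most
`3` in the other coordinates. -/
def sexticExponents : Fin 34 → Fin 4 → ℕ :=
    ![![2, 0, 1, 3], ![2, 0, 2, 2], ![2, 0, 3, 1], ![2, 1, 0, 3], ![2, 1, 1, 2], ![2, 1, 2, 1],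
    ![2, 1, 3, 0], ![2, 2, 0, 2], ![2, 2, 1, 1], ![2, 2, 2, 0], ![2, 3, 0, 1], ![2, 3, 1, 0],
    ![1, 0, 2, 3], ![1, 0, 3, 2], ![1, 1, 1, 3], ![1, 1, 2, 2], ![1, 1, 3, 1], ![1, 2, 0, 3],
    ![1, 2, 1, 2], ![1, 2, 2, 1], ![1, 2, 3, 0], ![1, 3, 0, 2], ![1, 3, 1, 1], ![1, 3, 2, 0],
    ![0, 0, 3, 3], ![0, 1, 2, 3], ![0, 1, 3, 2], ![0, 2, 1, 3], ![0, 2, 2, 2], ![0, 2, 3, 1],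
    ![0, 3, 0, 3], ![0, 3, 1, 2], ![0, 3, 2, 1], ![0, 3, 3, 0]]

theorem sexticExponents_injective : Function.Injective sexticExponents := by
  decide +kernel

theorem exists_sexticExponents {e : Fin 4 → ℕ} (h0 : e 0 ≤ 2) (h1 : e 1 ≤ 3) (h2 : e 2 ≤ 3)
    (h3 : e 3 ≤ 3) (h : e 0 + e 1 + e 2 + e 3 = 6) : ∃ k, sexticExponents k = e := by
  have key : ∀ (a : Fin 3) (b c d : Fin 4), (a + b + c + d : ℕ) = 6 →
      ∃ k, sexticExponents k = ![(a : ℕ), b, c, d] := by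
    decide +kernel
  obtain ⟨k, hk⟩ := key ⟨e 0, by omega⟩ ⟨e 1, by omega⟩ ⟨e 2, by omega⟩ ⟨e 3, by omega⟩ h
  refine ⟨k, hk.trans ?_⟩
  funext i
  fin_cases i <;> rfl

/-- A sextic of multiplicity `m` at a coordinate point has degree at most `6 - m` in that
coordinate, here `2` in `t₀` and `3` in the others. -/
theorem eq_sum_monomial {F : MvPolynomial (Fin 4) ℂ} (hF : F.IsHomogeneous 6)
    (h0 : MultAt F (Pi.single 0 1) 4) (h : ∀ i : Fin 4, i ≠ 0 → MultAt F (Pi.single i 1) 3) :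
    ∃ c : Fin 34 → ℂ,
      F = ∑ k, monomial (Finsupp.equivFunOnFinite.symm (sexticExponents k)) (c k) := by
  classical
  refine ⟨fun k => coeff (Finsupp.equivFunOnFinite.symm (sexticExponents k)) F, ?_⟩
  rw [← Finset.sum_image (s := Finset.univ)
    (g := fun k => Finsupp.equivFunOnFinite.symm (sexticExponents k))
    (f := fun e => monomial e (coeff e F))
    fun a _ b _ hab => sexticExponents_injective (Finsupp.equivFunOnFinite.symm.injective hab)]
  conv_lhs => rw [F.as_sum]
  refine Finset.sum_subset (fun e he => ?_) fun e _ he => by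
    rw [notMem_support_iff.1 he, map_zero]
  have b0 := h0.add_le_of_mem_support hF he
  have b1 := (h 1 (by decide)).add_le_of_mem_support hF he
  have b2 := (h 2 (by decide)).add_le_of_mem_support hF he
  have b3 := (h 3 (by decide)).add_le_of_mem_support hF he
  have hdeg : e 0 + e 1 + e 2 + e 3 = 6 := by
    have := hF.degree_eq_sum_deg_support he
    rw [Finset.sum_subset (Finset.subset_univ e.support) fun i _ hi => by
      simpa using hi, Fin.sum_univ_four] at this
    exact this.symm
  obtain ⟨k, hk⟩ := exists_sexticExponents (e := e) (by omega) (by omega) (by omega) (by omega) hdeg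
  exact Finset.mem_image.2 ⟨k, Finset.mem_univ k, by rw [hk]; exact e.equivFunOnFinite_symm_coe⟩

/-- The value of a partial derivative of a monomial at an integral point. -/
def partialDerivativeValue (a : Fin 4 → ℤ) (i : Fin 4) (e : Fin 4 → ℕ) : ℤ :=
  -- The truncated subtraction is harmless: when `e i = 0` the factor `e i` vanishes.
  e i * (a 0 ^ (e 0 - if 0 = i then 1 else 0) * a 1 ^ (e 1 - if 1 = i then 1 else 0) *
    a 2 ^ (e 2 - if 2 = i then 1 else 0) * a 3 ^ (e 3 - if 3 = i then 1 else 0))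

theorem eval_pderiv_monomial (a : Fin 4 → ℤ) (i : Fin 4) (e : Fin 4 → ℕ) (c : ℂ) :
    eval (fun j => (a j : ℂ)) (pderiv i (monomial (Finsupp.equivFunOnFinite.symm e) c)) =
      c * partialDerivativeValue a i e := by
  classical
  rw [pderiv_monomial, eval_monomial, Finsupp.prod_fintype _ _ fun _ => pow_zero _,
    partialDerivativeValue, Fin.prod_univ_four]
  simp [Finsupp.single_apply, eq_comm, mul_assoc]

set_option maxHeartbeats 2000000 in
/-- The linear system is spanned by the eleven sextics. -/
theorem exists_eq_sum_sexticGenerator {F : MvPolynomial (Fin 4) ℂ} (hF : F.IsHomogeneous 6)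
    (h0 : MultAt F (Pi.single 0 1) 4) (h : ∀ i : Fin 4, i ≠ 0 → MultAt F (Pi.single i 1) 3)
    (hr : ∀ (i : Fin 4) (t : Fin 4 → ℂ), i ≠ 0 → t ≠ 0 → t i = 0 → t 1 + t 2 + t 3 = 0 →
      MultAt F t 2) :
    ∃ μ : Fin 11 → ℂ, F = ∑ k, μ k • sexticGenerator k := by
  obtain ⟨c, rfl⟩ := eq_sum_monomial hF h0 h
  -- Each integral point of a double line and each partial derivative give one linear equation in
  -- the 34 coefficients.
  have key : ∀ (a : Fin 4 → ℤ) (i j : Fin 4) (N : Fin 34 → ℤ),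
      (j ≠ 0 ∧ a ≠ 0 ∧ a j = 0 ∧ a 1 + a 2 + a 3 = 0) →
      (∀ k, partialDerivativeValue a i (sexticExponents k) = N k) → ∑ k, c k * (N k : ℂ) = 0 := by
    rintro a i j N ⟨hj, ha, haj, hl⟩ hN
    have := (hr j (fun j => (a j : ℂ)) hj (fun h0 => ha (funext fun j => by
      simpa using congrFun h0 j)) (by simp [haj]) (by exact_mod_cast hl)).eval_pderiv i
    simpa only [map_sum, eval_pderiv_monomial, hN] using this
  clear hr h h0 hF
  -- The points have `t₀ = 0, 1, -1` on each line; three values suffice for derivatives of degree at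
  -- most two in `t₀`. Of the equations from `∂₁, ∂₂, ∂₃`, the 23 used here are independent and
  -- imply the others.
  have e0 : -c 25 + c 26 = 0 := by
    have := key ![0, 0, 1, -1] 1 1
      ![0, 0, 0, 0, 0, 0, 0, 0, 0, 0, 0, 0, 0, 0, 0, 0, 0, 0, 0, 0, 0, 0, 0, 0, 0, -1, 1, 0, 0,
      0, 0, 0, 0, 0]
      (by decide) (by decide +kernel)
    simp [Fin.sum_univ_succ] at this
    linear_combination this
  have e1 : -3 * c 24 = 0 := by
    have := key ![0, 0, 1, -1] 2 1
      ![0, 0, 0, 0, 0, 0, 0, 0, 0, 0, 0, 0, 0, 0, 0, 0, 0, 0, 0, 0, 0, 0, 0, 0, -3, 0, 0, 0, 0,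
      0, 0, 0, 0, 0]
      (by decide) (by decide +kernel)
    simp [Fin.sum_univ_succ] at this
    linear_combination -3 * this
  have e3 : -3 * c 30 = 0 := by
    have := key ![0, 1, 0, -1] 1 2
      ![0, 0, 0, 0, 0, 0, 0, 0, 0, 0, 0, 0, 0, 0, 0, 0, 0, 0, 0, 0, 0, 0, 0, 0, 0, 0, 0, 0, 0,
      0, -3, 0, 0, 0]
      (by decide) (by decide +kernel)
    simp [Fin.sum_univ_succ] at this
    linear_combination -3 * this
  have e4 : -c 27 + c 31 = 0 := by
    have := key ![0, 1, 0, -1] 2 2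
      ![0, 0, 0, 0, 0, 0, 0, 0, 0, 0, 0, 0, 0, 0, 0, 0, 0, 0, 0, 0, 0, 0, 0, 0, 0, 0, 0, -1, 0,
      0, 0, 1, 0, 0]
      (by decide) (by decide +kernel)
    simp [Fin.sum_univ_succ] at this
    linear_combination this
  have e6 : -3 * c 33 = 0 := by
    have := key ![0, 1, -1, 0] 1 3
      ![0, 0, 0, 0, 0, 0, 0, 0, 0, 0, 0, 0, 0, 0, 0, 0, 0, 0, 0, 0, 0, 0, 0, 0, 0, 0, 0, 0, 0,
      0, 0, 0, 0, -3]
      (by decide) (by decide +kernel)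
    simp [Fin.sum_univ_succ] at this
    linear_combination -3 * this
  have e8 : -c 29 + c 32 = 0 := by
    have := key ![0, 1, -1, 0] 3 3
      ![0, 0, 0, 0, 0, 0, 0, 0, 0, 0, 0, 0, 0, 0, 0, 0, 0, 0, 0, 0, 0, 0, 0, 0, 0, 0, 0, 0, 0,
      -1, 0, 0, 1, 0]
      (by decide) (by decide +kernel)
    simp [Fin.sum_univ_succ] at this
    linear_combination this
  have e9 : -c 3 + c 4 - c 5 + c 6 - c 14 + c 15 - c 16 - c 25 + c 26 = 0 := by
    have := key ![1, 0, 1, -1] 1 1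
      ![0, 0, 0, -1, 1, -1, 1, 0, 0, 0, 0, 0, 0, 0, -1, 1, -1, 0, 0, 0, 0, 0, 0, 0, 0, -1, 1,
      0, 0, 0, 0, 0, 0, 0]
      (by decide) (by decide +kernel)
    simp [Fin.sum_univ_succ] at this
    linear_combination this
  have e10 : -c 0 + 2 * c 1 - 3 * c 2 - 2 * c 12 + 3 * c 13 - 3 * c 24 = 0 := by
    have := key ![1, 0, 1, -1] 2 1
      ![-1, 2, -3, 0, 0, 0, 0, 0, 0, 0, 0, 0, -2, 3, 0, 0, 0, 0, 0, 0, 0, 0, 0, 0, -3, 0, 0, 0,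
      0, 0, 0, 0, 0, 0]
      (by decide) (by decide +kernel)
    simp [Fin.sum_univ_succ] at this
    linear_combination this
  have e11 : 3 * c 0 - 2 * c 1 + c 2 + 3 * c 12 - 2 * c 13 + 3 * c 24 = 0 := by
    have := key ![1, 0, 1, -1] 3 1
      ![3, -2, 1, 0, 0, 0, 0, 0, 0, 0, 0, 0, 3, -2, 0, 0, 0, 0, 0, 0, 0, 0, 0, 0, 3, 0, 0, 0,
      0, 0, 0, 0, 0, 0]
      (by decide) (by decide +kernel)
    simp [Fin.sum_univ_succ] at this
    linear_combination this
  have e12 : -c 3 + 2 * c 7 - 3 * c 10 - 2 * c 17 + 3 * c 21 - 3 * c 30 = 0 := by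
    have := key ![1, 1, 0, -1] 1 2
      ![0, 0, 0, -1, 0, 0, 0, 2, 0, 0, -3, 0, 0, 0, 0, 0, 0, -2, 0, 0, 0, 3, 0, 0, 0, 0, 0, 0,
      0, 0, -3, 0, 0, 0]
      (by decide) (by decide +kernel)
    simp [Fin.sum_univ_succ] at this
    linear_combination this
  have e13 : -c 0 + c 4 - c 8 + c 11 - c 14 + c 18 - c 22 - c 27 + c 31 = 0 := by
    have := key ![1, 1, 0, -1] 2 2
      ![-1, 0, 0, 0, 1, 0, 0, 0, -1, 0, 0, 1, 0, 0, -1, 0, 0, 0, 1, 0, 0, 0, -1, 0, 0, 0, 0,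
      -1, 0, 0, 0, 1, 0, 0]
      (by decide) (by decide +kernel)
    simp [Fin.sum_univ_succ] at this
    linear_combination this
  have e14 : 3 * c 3 - 2 * c 7 + c 10 + 3 * c 17 - 2 * c 21 + 3 * c 30 = 0 := by
    have := key ![1, 1, 0, -1] 3 2
      ![0, 0, 0, 3, 0, 0, 0, -2, 0, 0, 1, 0, 0, 0, 0, 0, 0, 3, 0, 0, 0, -2, 0, 0, 0, 0, 0, 0,
      0, 0, 3, 0, 0, 0]
      (by decide) (by decide +kernel)
    simp [Fin.sum_univ_succ] at this
    linear_combination this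
  have e15 : -c 6 + 2 * c 9 - 3 * c 11 - 2 * c 20 + 3 * c 23 - 3 * c 33 = 0 := by
    have := key ![1, 1, -1, 0] 1 3
      ![0, 0, 0, 0, 0, 0, -1, 0, 0, 2, 0, -3, 0, 0, 0, 0, 0, 0, 0, 0, -2, 0, 0, 3, 0, 0, 0, 0,
      0, 0, 0, 0, 0, -3]
      (by decide) (by decide +kernel)
    simp [Fin.sum_univ_succ] at this
    linear_combination this
  have e16 : 3 * c 6 - 2 * c 9 + c 11 + 3 * c 20 - 2 * c 23 + 3 * c 33 = 0 := by
    have := key ![1, 1, -1, 0] 2 3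
      ![0, 0, 0, 0, 0, 0, 3, 0, 0, -2, 0, 1, 0, 0, 0, 0, 0, 0, 0, 0, 3, 0, 0, -2, 0, 0, 0, 0,
      0, 0, 0, 0, 0, 3]
      (by decide) (by decide +kernel)
    simp [Fin.sum_univ_succ] at this
    linear_combination this
  have e17 : -c 2 + c 5 - c 8 + c 10 - c 16 + c 19 - c 22 - c 29 + c 32 = 0 := by
    have := key ![1, 1, -1, 0] 3 3
      ![0, 0, -1, 0, 0, 1, 0, 0, -1, 0, 1, 0, 0, 0, 0, 0, -1, 0, 0, 1, 0, 0, -1, 0, 0, 0, 0, 0,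
      0, -1, 0, 0, 1, 0]
      (by decide) (by decide +kernel)
    simp [Fin.sum_univ_succ] at this
    linear_combination this
  have e18 : -c 3 + c 4 - c 5 + c 6 + c 14 - c 15 + c 16 - c 25 + c 26 = 0 := by
    have := key ![-1, 0, 1, -1] 1 1
      ![0, 0, 0, -1, 1, -1, 1, 0, 0, 0, 0, 0, 0, 0, 1, -1, 1, 0, 0, 0, 0, 0, 0, 0, 0, -1, 1, 0,
      0, 0, 0, 0, 0, 0]
      (by decide) (by decide +kernel)
    simp [Fin.sum_univ_succ] at this
    linear_combination this
  have e19 : -c 0 + 2 * c 1 - 3 * c 2 + 2 * c 12 - 3 * c 13 - 3 * c 24 = 0 := by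
    have := key ![-1, 0, 1, -1] 2 1
      ![-1, 2, -3, 0, 0, 0, 0, 0, 0, 0, 0, 0, 2, -3, 0, 0, 0, 0, 0, 0, 0, 0, 0, 0, -3, 0, 0, 0,
      0, 0, 0, 0, 0, 0]
      (by decide) (by decide +kernel)
    simp [Fin.sum_univ_succ] at this
    linear_combination this
  have e20 : 3 * c 0 - 2 * c 1 + c 2 - 3 * c 12 + 2 * c 13 + 3 * c 24 = 0 := by
    have := key ![-1, 0, 1, -1] 3 1
      ![3, -2, 1, 0, 0, 0, 0, 0, 0, 0, 0, 0, -3, 2, 0, 0, 0, 0, 0, 0, 0, 0, 0, 0, 3, 0, 0, 0,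
      0, 0, 0, 0, 0, 0]
      (by decide) (by decide +kernel)
    simp [Fin.sum_univ_succ] at this
    linear_combination this
  have e21 : -c 3 + 2 * c 7 - 3 * c 10 + 2 * c 17 - 3 * c 21 - 3 * c 30 = 0 := by
    have := key ![-1, 1, 0, -1] 1 2
      ![0, 0, 0, -1, 0, 0, 0, 2, 0, 0, -3, 0, 0, 0, 0, 0, 0, 2, 0, 0, 0, -3, 0, 0, 0, 0, 0, 0,
      0, 0, -3, 0, 0, 0]
      (by decide) (by decide +kernel)
    simp [Fin.sum_univ_succ] at this
    linear_combination this
  have e22 : -c 0 + c 4 - c 8 + c 11 + c 14 - c 18 + c 22 - c 27 + c 31 = 0 := by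
    have := key ![-1, 1, 0, -1] 2 2
      ![-1, 0, 0, 0, 1, 0, 0, 0, -1, 0, 0, 1, 0, 0, 1, 0, 0, 0, -1, 0, 0, 0, 1, 0, 0, 0, 0, -1,
      0, 0, 0, 1, 0, 0]
      (by decide) (by decide +kernel)
    simp [Fin.sum_univ_succ] at this
    linear_combination this
  have e23 : 3 * c 3 - 2 * c 7 + c 10 - 3 * c 17 + 2 * c 21 + 3 * c 30 = 0 := by
    have := key ![-1, 1, 0, -1] 3 2
      ![0, 0, 0, 3, 0, 0, 0, -2, 0, 0, 1, 0, 0, 0, 0, 0, 0, -3, 0, 0, 0, 2, 0, 0, 0, 0, 0, 0,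
      0, 0, 3, 0, 0, 0]
      (by decide) (by decide +kernel)
    simp [Fin.sum_univ_succ] at this
    linear_combination this
  have e24 : -c 6 + 2 * c 9 - 3 * c 11 + 2 * c 20 - 3 * c 23 - 3 * c 33 = 0 := by
    have := key ![-1, 1, -1, 0] 1 3
      ![0, 0, 0, 0, 0, 0, -1, 0, 0, 2, 0, -3, 0, 0, 0, 0, 0, 0, 0, 0, 2, 0, 0, -3, 0, 0, 0, 0,
      0, 0, 0, 0, 0, -3]
      (by decide) (by decide +kernel)
    simp [Fin.sum_univ_succ] at this
    linear_combination this
  have e25 : 3 * c 6 - 2 * c 9 + c 11 - 3 * c 20 + 2 * c 23 + 3 * c 33 = 0 := by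
    have := key ![-1, 1, -1, 0] 2 3
      ![0, 0, 0, 0, 0, 0, 3, 0, 0, -2, 0, 1, 0, 0, 0, 0, 0, 0, 0, 0, -3, 0, 0, 2, 0, 0, 0, 0,
      0, 0, 0, 0, 0, 3]
      (by decide) (by decide +kernel)
    simp [Fin.sum_univ_succ] at this
    linear_combination this
  clear key
  -- Gaussian elimination: 23 coefficients are expressed through the eleven free ones `c 5, c 8, c
  -- 10, c 11, c 18, c 19, c 22, c 26, c 28, c 31, c 32`.
  have p0 : c 0 = c 5 - c 8 + c 10 := by
    linear_combination
      -e0 + e4 + 1 / 2 * e9 + 1 / 4 * e12 - 1 / 2 * e13 + 1 / 4 * e14 - 1 / 4 * e15 - 1 / 4 *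
      e16 + 1 / 2 * e18 + 1 / 4 * e21 - 1 / 2 * e22 + 1 / 4 * e23 - 1 / 4 * e24 - 1 / 4 * e25
  have p1 : c 1 = 2 * c 5 - 2 * c 8 + 2 * c 10 := by
    linear_combination
      -2 * e0 - 1 / 2 * e1 + 2 * e4 + e9 - 1 / 8 * e10 - 3 / 8 * e11 + 1 / 2 * e12 - e13 + 1 /
      2 * e14 - 1 / 2 * e15 - 1 / 2 * e16 + e18 - 1 / 8 * e19 - 3 / 8 * e20 + 1 / 2 * e21 - e22
      + 1 / 2 * e23 - 1 / 2 * e24 - 1 / 2 * e25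
  have p2 : c 2 = c 5 - c 8 + c 10 := by
    linear_combination
      -e0 + e4 + 1 / 2 * e9 - 1 / 4 * e10 - 1 / 4 * e11 + 1 / 4 * e12 - 1 / 2 * e13 + 1 / 4 *
      e14 - 1 / 4 * e15 - 1 / 4 * e16 + 1 / 2 * e18 - 1 / 4 * e19 - 1 / 4 * e20 + 1 / 4 * e21 -
      1 / 2 * e22 + 1 / 4 * e23 - 1 / 4 * e24 - 1 / 4 * e25
  have p3 : c 3 = c 10 := by
    linear_combination
      1 / 4 * e12 + 1 / 4 * e14 + 1 / 4 * e21 + 1 / 4 * e23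
  have p4 : c 4 = c 5 + c 10 - c 11 := by
    linear_combination
      -e0 + 1 / 2 * e9 + 1 / 4 * e12 + 1 / 4 * e14 - 1 / 4 * e15 - 1 / 4 * e16 + 1 / 2 * e18 +
      1 / 4 * e21 + 1 / 4 * e23 - 1 / 4 * e24 - 1 / 4 * e25
  have p6 : c 6 = c 11 := by
    linear_combination
      1 / 4 * e15 + 1 / 4 * e16 + 1 / 4 * e24 + 1 / 4 * e25
  have p7 : c 7 = 2 * c 10 := by
    linear_combination
      -1 / 2 * e3 + 3 / 8 * e12 + 1 / 8 * e14 + 3 / 8 * e21 + 1 / 8 * e23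
  have p9 : c 9 = 2 * c 11 := by
    linear_combination
      -1 / 2 * e6 + 3 / 8 * e15 + 1 / 8 * e16 + 3 / 8 * e24 + 1 / 8 * e25
  have p12 : c 12 = 0 := by
    linear_combination
      1 / 5 * e10 + 3 / 10 * e11 - 1 / 5 * e19 - 3 / 10 * e20
  have p13 : c 13 = 0 := by
    linear_combination
      3 / 10 * e10 + 1 / 5 * e11 - 3 / 10 * e19 - 1 / 5 * e20
  have p14 : c 14 = c 18 - c 22 := by
    linear_combination
      -1 / 2 * e13 + 1 / 2 * e22
  have p15 : c 15 = c 18 + c 19 - 2 * c 22 := by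
    linear_combination
      e0 - e4 + e8 + 1 / 4 * e10 + 1 / 4 * e11 - 1 / 4 * e12 - 1 / 4 * e14 + 1 / 4 * e15 + 1 /
      4 * e16 - e17 - e18 + 1 / 4 * e19 + 1 / 4 * e20 - 1 / 4 * e21 + e22 - 1 / 4 * e23 + 1 / 4
      * e24 + 1 / 4 * e25
  have p16 : c 16 = c 19 - c 22 := by
    linear_combination
      e0 - e4 + e8 - 1 / 2 * e9 + 1 / 4 * e10 + 1 / 4 * e11 - 1 / 4 * e12 + 1 / 2 * e13 - 1 / 4
      * e14 + 1 / 4 * e15 + 1 / 4 * e16 - e17 - 1 / 2 * e18 + 1 / 4 * e19 + 1 / 4 * e20 - 1 / 4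
      * e21 + 1 / 2 * e22 - 1 / 4 * e23 + 1 / 4 * e24 + 1 / 4 * e25
  have p17 : c 17 = 0 := by
    linear_combination
      1 / 5 * e12 + 3 / 10 * e14 - 1 / 5 * e21 - 3 / 10 * e23
  have p20 : c 20 = 0 := by
    linear_combination
      1 / 5 * e15 + 3 / 10 * e16 - 1 / 5 * e24 - 3 / 10 * e25
  have p21 : c 21 = 0 := by
    linear_combination
      3 / 10 * e12 + 1 / 5 * e14 - 3 / 10 * e21 - 1 / 5 * e23
  have p23 : c 23 = 0 := by
    linear_combination
      3 / 10 * e15 + 1 / 5 * e16 - 3 / 10 * e24 - 1 / 5 * e25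
  have p24 : c 24 = 0 := by
    linear_combination
      -1 / 3 * e1
  have p25 : c 25 = c 26 := by
    linear_combination
      -e0
  have p27 : c 27 = c 31 := by
    linear_combination
      -e4
  have p29 : c 29 = c 32 := by
    linear_combination
      -e8
  have p30 : c 30 = 0 := by
    linear_combination
      -1 / 3 * e3
  have p33 : c 33 = 0 := by
    linear_combination
      -1 / 3 * e6
  clear e0 e1 e3 e4 e6 e8 e9 e10 e11 e12 e13 e14 e15 e16 e17 e18 e19 e20 e21 e22 e23 e24 e25
  refine ⟨![
    -c 5 + 2 * c 8 - 3 * c 10 - 2 * c 11, c 5 - c 8 + c 10, c 10, c 11, c 22, c 19 - c 22, c 18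
    - c 22, -c 26 + c 28 - c 31 - c 32, c 26, c 31, c 32],
    MvPolynomial.funext fun z => ?_⟩
  simp only [map_sum, eval_monomial, Finsupp.prod_fintype _ _ fun _ => pow_zero _,
    Finsupp.equivFunOnFinite_symm_apply_apply, Fin.prod_univ_four, smul_eval, eval_sexticGenerator]
  simp [Fin.sum_univ_succ, sexticExponents, sexticValue]
  linear_combination
    z 0 ^ 2 * z 2 * z 3 ^ 3 * p0 + z 0 ^ 2 * z 2 ^ 2 * z 3 ^ 2 * p1 + z 0 ^ 2 * z 2 ^ 3 * z 3 *
    p2 + z 0 ^ 2 * z 1 * z 3 ^ 3 * p3 + z 0 ^ 2 * z 1 * z 2 * z 3 ^ 2 * p4 + z 0 ^ 2 * z 1 * z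
    2 ^ 3 * p6 + z 0 ^ 2 * z 1 ^ 2 * z 3 ^ 2 * p7 + z 0 ^ 2 * z 1 ^ 2 * z 2 ^ 2 * p9 + z 0 * z
    2 ^ 2 * z 3 ^ 3 * p12 + z 0 * z 2 ^ 3 * z 3 ^ 2 * p13 + z 0 * z 1 * z 2 * z 3 ^ 3 * p14 + z
    0 * z 1 * z 2 ^ 2 * z 3 ^ 2 * p15 + z 0 * z 1 * z 2 ^ 3 * z 3 * p16 + z 0 * z 1 ^ 2 * z 3 ^
    3 * p17 + z 0 * z 1 ^ 2 * z 2 ^ 3 * p20 + z 0 * z 1 ^ 3 * z 3 ^ 2 * p21 + z 0 * z 1 ^ 3 * z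
    2 ^ 2 * p23 + z 2 ^ 3 * z 3 ^ 3 * p24 + z 1 * z 2 ^ 2 * z 3 ^ 3 * p25 + z 1 ^ 2 * z 2 * z 3
    ^ 3 * p27 + z 1 ^ 2 * z 2 ^ 3 * z 3 * p29 + z 1 ^ 3 * z 3 ^ 3 * p30 + z 1 ^ 3 * z 2 ^ 3 *
    p33

theorem sum_mul_recombine {R : Type*} [CommRing R] (c f : Fin 11 → R) :
    ∑ i, c i * recombine f i =
      (-c 0 + 2 * c 1 + 2 * c 2 - 2 * c 3) * f 0 + (c 0 + 2 * c 1 - 2 * c 2 - 2 * c 3) * f 1 +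
      (c 0 + 2 * c 1 + 2 * c 2 + 2 * c 3) * f 2 + (c 0 - 2 * c 1 + 2 * c 2 - 2 * c 3) * f 3 +
      (4 * c 8 - 4 * c 10) * f 4 + (4 * c 8 - 4 * c 9) * f 5 + (-4 * c 9 - 4 * c 10) * f 6 +
      (c 4 - 2 * c 5 - 2 * c 6 + 2 * c 7) * f 7 + (-c 4 - 2 * c 5 + 2 * c 6 + 2 * c 7) * f 8 +
      (-c 4 - 2 * c 5 - 2 * c 6 - 2 * c 7) * f 9 + (-c 4 + 2 * c 5 - 2 * c 6 + 2 * c 7) * f 10 := by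
  simp [Fin.sum_univ_succ, recombine]
  ring

theorem eq_zero_of_sum_mul_recombine {c : Fin 11 → ℂ}
    (h : ∀ t₀ t₁ t₂ t₃ : ℂ,
      ∑ i, c i * recombine (sexticValue t₀ (t₁ + t₂ + t₃) t₁ t₂ t₃) i = 0) : c = 0 := by
  simp only [sum_mul_recombine, sexticValue, Matrix.cons_val] at h
  -- The names `m0, …, m10` refer to the coefficients of the eleven products. On the face `t₁ = 0`
  -- only the product with index `1` survives, and similarly for the next two; on `t₀ = l = 0` only
  -- index `7` does.
  have m1 : c 0 + 2 * c 1 - 2 * c 2 - 2 * c 3 = 0 := by linear_combination h 1 0 1 1 / 4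
  have m2 : c 0 + 2 * c 1 + 2 * c 2 + 2 * c 3 = 0 := by linear_combination h 1 1 0 1 / 4
  have m3 : c 0 - 2 * c 1 + 2 * c 2 - 2 * c 3 = 0 := by linear_combination h 1 1 1 0 / 4
  have m7 : c 4 - 2 * c 5 - 2 * c 6 + 2 * c 7 = 0 := by linear_combination h 0 1 1 (-2) / 4
  have a1 := h 0 1 1 (-1)
  have a2 := h 0 1 (-1) 1
  have a3 := h 0 (-1) 1 1
  have m8 : -c 4 - 2 * c 5 + 2 * c 6 + 2 * c 7 = 0 := by
    linear_combination (a1 + a2) / 2 - m7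
  have m9 : -c 4 - 2 * c 5 - 2 * c 6 - 2 * c 7 = 0 := by
    linear_combination (a1 + a3) / 2 - m7
  have m10 : -c 4 + 2 * c 5 - 2 * c 6 + 2 * c 7 = 0 := by
    linear_combination (a2 + a3) / 2 - m7
  -- The products with indices `4, 5, 6` are the ones odd in `t₀`, so a change of sign of `t₀`
  -- separates them from the rest.
  have b1 := h 1 1 1 1
  have b2 := h (-1) 1 1 1
  have b3 := h 1 1 1 (-1)
  have b4 := h (-1) 1 1 (-1)
  have b5 := h 1 1 (-1) 1
  have b6 := h (-1) 1 (-1) 1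
  have s : (4 * c 8 - 4 * c 10) + (4 * c 8 - 4 * c 9) + (-4 * c 9 - 4 * c 10) = 0 := by
    linear_combination (b1 - b2) / 6
  have m6 : -4 * c 9 - 4 * c 10 = 0 := by linear_combination (b3 - b4) / 4 + s / 2
  have m5 : 4 * c 8 - 4 * c 9 = 0 := by linear_combination (b5 - b6) / 4 + s / 2
  have m0 : -c 0 + 2 * c 1 + 2 * c 2 - 2 * c 3 = 0 := by
    linear_combination (b1 + b2) / 6 - 3 * (m1 + m2 + m3) - m7 / 3 - (m8 + m9 + m10)
  funext i
  fin_cases i <;> simp only [Fin.reduceFinMk, Fin.zero_eta, Fin.mk_one, Pi.zero_apply]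
  · linear_combination (m1 + m2 + m3 - m0) / 4
  · linear_combination (m0 + m1 + m2 - m3) / 8
  · linear_combination (m0 - m1 + m2 + m3) / 8
  · linear_combination (m2 - m0 - m1 - m3) / 8
  · linear_combination (m7 - m8 - m9 - m10) / 4
  · linear_combination (m10 - m7 - m8 - m9) / 8
  · linear_combination (m8 - m7 - m9 - m10) / 8
  · linear_combination (m7 + m8 - m9 + m10) / 8
  · linear_combination (s - 2 * m6) / 8
  · linear_combination (s - 2 * m6 - 2 * m5) / 8
  · linear_combination (2 * m5 - s) / 8

/-- Each generator omits at most one of the factors `t₁, t₂, t₃`, and those without the factor `t₀`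
omit none. -/
theorem eval_sexticGenerator_edge {t : Fin 4 → ℂ} {i j : Fin 4} (hij : i ≠ j) (hi : t i = 0)
    (hj : t j = 0) (k : Fin 11) : eval t (sexticGenerator k) = 0 := by
  rw [eval_sexticGenerator]
  revert hi hj hij
  fin_cases i <;> fin_cases j <;> simp <;> intro hi hj <;> fin_cases k <;>
    simp [sexticValue, hi, hj]

/-! ### Adapted coordinates -/

theorem map_mem_face_iff {v : Fin 4 → PSpace 3} {T : (Fin 4 → ℂ) ≃ₗ[ℂ] (Fin 4 → ℂ)}
    (hT : ∀ i, (v i).submodule = Submodule.span ℂ {T (Pi.single i 1)}) (i : Fin 4)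
    (t : Fin 4 → ℂ) : T t ∈ face v i ↔ t i = 0 := by
  constructor
  · intro h
    have hle : face v i ≤ LinearMap.ker (LinearMap.proj i ∘ₗ T.symm.toLinearMap) := by
      refine iSup₂_le fun j hj => ?_
      rw [hT, Submodule.span_singleton_le_iff_mem, LinearMap.mem_ker]
      simp [hj.symm]
    simpa using hle h
  · intro h
    have ht : T t = ∑ j, t j • T (Pi.single j 1) := by
      conv_lhs => rw [← LinearMap.sum_single_apply (fun _ => ℂ) t, map_sum]
      refine Finset.sum_congr rfl fun j _ => ?_
      rw [← map_smul, ← Pi.single_smul, smul_eq_mul, mul_one]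
    rw [ht]
    refine Submodule.sum_mem _ fun j _ => ?_
    by_cases hj : j = i
    · rw [hj, h, zero_smul]
      exact zero_mem _
    · refine Submodule.smul_mem _ _ ((le_iSup₂ (f := fun j (_ : j ≠ i) => (v j).submodule) j hj) ?_)
      rw [hT]
      exact Submodule.mem_span_singleton_self _

theorem exists_dual_ker_eq {V : Type*} [AddCommGroup V] [Module ℂ V] [FiniteDimensional ℂ V]
    {H : Submodule ℂ V} (h : Module.finrank ℂ H + 1 = Module.finrank ℂ V) :
    ∃ f : Module.Dual ℂ V, LinearMap.ker f = H := by
  obtain ⟨f, hf, hle⟩ := Submodule.exists_le_ker_of_lt_top H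
    (lt_top_iff_ne_top.2 fun htop => by
      rw [htop, finrank_top] at h
      omega)
  refine ⟨f, (Submodule.eq_of_le_of_finrank_eq hle ?_).symm⟩
  have := Module.Dual.finrank_ker_add_one_of_ne_zero hf
  omega

/-- Coordinates in which the vertices of the tetrahedron are the coordinate points and the plane
has equation `t₁ + t₂ + t₃ = 0`. -/
theorem exists_adapted_coordinates (v : Fin 4 → PSpace 3) (hv : Projectivization.Independent v)
    (H : Submodule ℂ (Fin 4 → ℂ)) (hH : Module.finrank ℂ H = 3) (hH0 : (v 0).submodule ≤ H)
    (hline : ∀ i : Fin 4, i ≠ 0 → Module.finrank ℂ (trace v H i) = 2)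
    (hdist : ∀ i j : Fin 4, i ≠ 0 → j ≠ 0 → i ≠ j → trace v H i ≠ trace v H j) :
    ∃ T : (Fin 4 → ℂ) ≃ₗ[ℂ] (Fin 4 → ℂ),
      (∀ i, (v i).submodule = Submodule.span ℂ {T (Pi.single i 1)}) ∧
        ∀ t, T t ∈ H ↔ t 1 + t 2 + t 3 = 0 := by
  have hli := Projectivization.independent_iff.1 hv
  let b := basisOfLinearIndependentOfCardEqFinrank hli (by simp)
  have hb : ∀ i, b i = (v i).rep := fun i => by
    simp [b, coe_basisOfLinearIndependentOfCardEqFinrank]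
  have hbspan : ∀ i, (v i).submodule = Submodule.span ℂ {b i} := fun i => by
    rw [hb, Projectivization.submodule_eq]
  obtain ⟨h, rfl⟩ := exists_dual_ker_eq (H := H) (by simp [hH])
  have h0 : h (b 0) = 0 := by
    rw [hbspan] at hH0
    exact hH0 (Submodule.mem_span_singleton_self _)
  -- If the plane contained `v i`, the line through `v 0` and `v i` would be its trace on both other
  -- faces through `v 0`, against `hdist`.
  have hne : ∀ i : Fin 4, i ≠ 0 → h (b i) ≠ 0 := by
    intro i hi hz
    have hex : ∀ i : Fin 4, i ≠ 0 → ∃ j k : Fin 4, j ≠ 0 ∧ k ≠ 0 ∧ j ≠ k ∧ i ≠ j ∧ i ≠ k := by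
      decide
    obtain ⟨j, k, hj, hk, hjk, hij, hik⟩ := hex i hi
    let W := Submodule.span ℂ (Set.range (b ∘ ![0, i]))
    have hW : Module.finrank ℂ W = 2 := by
      have hinj : Function.Injective ![0, i] := by
        intro x y
        fin_cases x <;> fin_cases y <;> simp [hi, hi.symm]
      simpa using finrank_span_eq_card (b.linearIndependent.comp _ hinj)
    have hface : ∀ m l : Fin 4, m ≠ l → b m ∈ face v l := fun m l hml => by
      refine (le_iSup₂ (f := fun j (_ : j ≠ l) => (v j).submodule) m hml) ?_
      rw [hbspan]
      exact Submodule.mem_span_singleton_self _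
    have hWle : ∀ l : Fin 4, l ≠ 0 → i ≠ l → W = trace v (LinearMap.ker h) l := by
      intro l hl hil
      refine Submodule.eq_of_le_of_finrank_eq ?_ (by rw [hW, hline l hl])
      rw [Submodule.span_le]
      rintro _ ⟨x, rfl⟩
      fin_cases x
      · exact ⟨h0, hface _ _ hl.symm⟩
      · exact ⟨hz, hface _ _ hil⟩
    exact hdist j k hj hk hjk ((hWle j hj hij).symm.trans (hWle k hk hik))
  -- Rescaling the basis vectors turns the equation of the plane into `t₁ + t₂ + t₃ = 0`.
  let w : Fin 4 → ℂ := fun i => if i = 0 then 1 else (h (b i))⁻¹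
  have hw0 : ∀ i, w i ≠ 0 := by
    intro i
    by_cases hi : i = 0
    · simp [w, hi]
    · simp [w, hi, hne i hi]
  have hw : ∀ i, IsUnit (w i) := fun i => (hw0 i).isUnit
  let b' := b.isUnitSMul hw
  have hb' : ∀ i, b' i = w i • b i := fun i => b.isUnitSMul_apply hw i
  have hT : ∀ i, b'.equivFun.symm (Pi.single i 1) = w i • b i := fun i => by
    rw [← hb', Module.Basis.equivFun_symm_apply]
    simp [Pi.single_apply]
  refine ⟨b'.equivFun.symm, fun i => ?_, fun t => ?_⟩
  · rw [hT, hbspan, Submodule.span_singleton_smul_eq (hw i)]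
  · rw [LinearMap.mem_ker, Module.Basis.equivFun_symm_apply, map_sum, Fin.sum_univ_four]
    simp [hb', w, h0, hne]

section AdaptedCoordinates

variable {v : Fin 4 → PSpace 3} {H : Submodule ℂ (Fin 4 → ℂ)}
  {T : (Fin 4 → ℂ) ≃ₗ[ℂ] (Fin 4 → ℂ)}

theorem symm_apply_eq_zero (hT : ∀ i, (v i).submodule = Submodule.span ℂ {T (Pi.single i 1)})
    {i j : Fin 4} (hij : j ≠ i) {a : Fin 4 → ℂ} (ha : a ∈ (v i).submodule) :
    T.symm a j = 0 := by
  rw [hT, Submodule.mem_span_singleton] at ha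
  obtain ⟨c, rfl⟩ := ha
  simp [hij]

theorem linSubst_sexticGenerator_mem
    (hT : ∀ i, (v i).submodule = Submodule.span ℂ {T (Pi.single i 1)})
    (hTH : ∀ t, T t ∈ H ↔ t 1 + t 2 + t 3 = 0) (k : Fin 11) :
    linSubst T.symm.toLinearMap (sexticGenerator k) ∈ sexticSystem v H := by
  refine ⟨IsHomogeneous.linSubst _ (sexticGenerator_isHomogeneous k), fun a ha _ => ?_,
    fun i hi a ha _ => ?_, fun i hi a ha _ => ?_⟩
  · exact (sexticGenerator_multAt_apex (fun j hj => symm_apply_eq_zero hT hj ha) k).linSubst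
      T.symm.toLinearMap
  · exact (sexticGenerator_multAt_vertex hi (fun j hj => symm_apply_eq_zero hT hj ha) k).linSubst
      T.symm.toLinearMap
  · obtain ⟨haH, haf⟩ := ha
    rw [SetLike.mem_coe, ← T.apply_symm_apply a] at haH haf
    exact (sexticGenerator_multAt_line hi ((map_mem_face_iff hT i _).1 haf)
      ((hTH _).1 haH) k).linSubst T.symm.toLinearMap

theorem linSubst_symm_linSubst (T : (Fin 4 → ℂ) ≃ₗ[ℂ] (Fin 4 → ℂ)) (F : MvPolynomial (Fin 4) ℂ) :
    linSubst T.symm.toLinearMap (linSubst T.toLinearMap F) = F :=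
  MvPolynomial.funext fun z => by simp [eval_linSubst]

theorem exists_eq_sum_linSubst_sexticGenerator
    (hT : ∀ i, (v i).submodule = Submodule.span ℂ {T (Pi.single i 1)})
    (hTH : ∀ t, T t ∈ H ↔ t 1 + t 2 + t 3 = 0) {F : MvPolynomial (Fin 4) ℂ}
    (hF : F ∈ sexticSystem v H) :
    ∃ μ : Fin 11 → ℂ, F = ∑ k, μ k • linSubst T.symm.toLinearMap (sexticGenerator k) := by
  obtain ⟨h6, h0, h1, h2⟩ := hF
  have hmem : ∀ i, T (Pi.single i 1) ∈ (v i).submodule := fun i => by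
    rw [hT]
    exact Submodule.mem_span_singleton_self _
  have hne : ∀ i : Fin 4, T (Pi.single i 1) ≠ 0 := fun i => by simp
  obtain ⟨μ, hμ⟩ := exists_eq_sum_sexticGenerator (F := linSubst T.toLinearMap F)
    (IsHomogeneous.linSubst _ h6) ((h0 _ (hmem 0) (hne 0)).linSubst T.toLinearMap)
    (fun i hi => (h1 i hi _ (hmem i) (hne i)).linSubst T.toLinearMap)
    (fun i t hi ht hti htl => (h2 i hi (T t) ⟨(hTH t).2 htl, (map_mem_face_iff hT i t).2 hti⟩
      (by simpa using ht)).linSubst T.toLinearMap)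
  refine ⟨μ, ?_⟩
  rw [← linSubst_symm_linSubst T F, hμ, map_sum]
  simp only [map_smul]

theorem polyMap_linSubst {k l m : ℕ} (ρ : (Fin l → ℂ) →ₗ[ℂ] (Fin k → ℂ))
    (F : Fin m → MvPolynomial (Fin k) ℂ) (z : Fin l → ℂ) :
    polyMap (fun i => linSubst ρ (F i)) z = polyMap F (ρ z) := by
  funext i
  exact eval_linSubst ρ (F i) z

theorem linearIndependent_linSubst_threefoldForm (T : (Fin 4 → ℂ) ≃ₗ[ℂ] (Fin 4 → ℂ)) :
    LinearIndependent ℂ fun i => linSubst T.symm.toLinearMap (threefoldForm i) := by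
  rw [Fintype.linearIndependent_iff]
  intro c hc
  refine congrFun (eq_zero_of_sum_mul_recombine (c := c) fun t₀ t₁ t₂ t₃ => ?_)
  have h := congrArg (eval (T ![t₀, t₁, t₂, t₃])) hc
  have hp : ∀ i, eval ![t₀, t₁, t₂, t₃] (threefoldForm i) =
      recombine (sexticValue t₀ (t₁ + t₂ + t₃) t₁ t₂ t₃) i :=
    fun i => congrFun (polyMap_threefoldForm ![t₀, t₁, t₂, t₃]) i
  simpa only [map_sum, smul_eval, eval_linSubst, LinearEquiv.coe_coe, T.symm_apply_apply, hp,
    map_zero] using h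

/-- The eleven recombined forms are independent, and the system is spanned by eleven generators;
comparing dimensions makes the former a basis. -/
theorem exists_basis_sexticSystem
    (hT : ∀ i, (v i).submodule = Submodule.span ℂ {T (Pi.single i 1)})
    (hTH : ∀ t, T t ∈ H ↔ t 1 + t 2 + t 3 = 0) :
    ∃ F : Module.Basis (Fin 11) ℂ (sexticSystem v H),
      ∀ i, (F i : MvPolynomial (Fin 4) ℂ) = linSubst T.symm.toLinearMap (threefoldForm i) := by
  let S := T.symm.toLinearMap
  have hmem : ∀ i, linSubst S (threefoldForm i) ∈ sexticSystem v H := fun i => by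
    rw [threefoldForm, ← AlgHom.coe_toRingHom, map_recombine]
    exact recombine_mem (sexticSystem v H) (linSubst_sexticGenerator_mem hT hTH) i
  let P : Fin 11 → sexticSystem v H := fun i => ⟨_, hmem i⟩
  have hP : LinearIndependent ℂ P :=
    LinearIndependent.of_comp (sexticSystem v H).subtype
      (linearIndependent_linSubst_threefoldForm T)
  have hle : sexticSystem v H ≤
      Submodule.span ℂ (Set.range fun k => linSubst S (sexticGenerator k)) := by
    intro F hF
    obtain ⟨μ, rfl⟩ := exists_eq_sum_linSubst_sexticGenerator hT hTH hF
    exact Submodule.sum_mem _ fun k _ =>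
      Submodule.smul_mem _ _ (Submodule.subset_span ⟨k, rfl⟩)
  have : FiniteDimensional ℂ
      (Submodule.span ℂ (Set.range fun k => linSubst S (sexticGenerator k))) :=
    FiniteDimensional.span_of_finite ℂ (Set.finite_range _)
  have : FiniteDimensional ℂ (sexticSystem v H) := Submodule.finiteDimensional_of_le hle
  have hcard : Fintype.card (Fin 11) = Module.finrank ℂ (sexticSystem v H) :=
    le_antisymm hP.fintype_card_le_finrank
      ((Submodule.finrank_mono hle).trans (finrank_range_le_card _))
  refine ⟨basisOfLinearIndependentOfCardEqFinrank hP hcard, fun i => ?_⟩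
  rw [coe_basisOfLinearIndependentOfCardEqFinrank]

end AdaptedCoordinates

theorem ratImage_comp_linearEquiv {n m : ℕ} (f : (Fin (n + 1) → ℂ) → (Fin (m + 1) → ℂ))
    (S : (Fin (n + 1) → ℂ) ≃ₗ[ℂ] (Fin (n + 1) → ℂ)) :
    ratImage (fun z => f (S z)) = ratImage f := by
  ext p
  induction p using Projectivization.ind with | _ w hw => ?_
  rw [mk_mem_ratImage, mk_mem_ratImage]
  refine forall₂_congr fun d G => imp_congr_right fun _ => imp_congr_left ?_
  refine ⟨fun h z hz hf => ?_, fun h z hz hf => h _ (by simpa using hz) hf⟩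
  have := h (S.symm z) (by simpa using hz) (by simpa using hf)
  simpa using this

end EnriquesFano

theorem mainTheorem5 (v : Fin 4 → EnriquesFano.PSpace 3) (hv : Projectivization.Independent v)
    (H : Submodule ℂ (Fin 4 → ℂ)) (hH : Module.finrank ℂ H = 3)
    (hH0 : (v 0).submodule ≤ H)
    (hline : ∀ i : Fin 4, i ≠ 0 → Module.finrank ℂ (EnriquesFano.trace v H i) = 2)
    (hdist : ∀ i j : Fin 4, i ≠ 0 → j ≠ 0 → i ≠ j →
      EnriquesFano.trace v H i ≠ EnriquesFano.trace v H j) :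
    (∃ F : Module.Basis (Fin 11) ℂ (EnriquesFano.sexticSystem v H),
      EnriquesFano.ratImage (n := 3) (m := 10)
          (EnriquesFano.polyMap fun i => (F i : MvPolynomial (Fin 4) ℂ)) =
        EnriquesFano.threefold ∧
      ∃ ρ : (Fin 11 → ℂ) →ₗ[ℂ] (Fin 4 → ℂ),
        LinearMap.ker ρ = EnriquesFano.projectionCentre ∧
        EnriquesFano.AreInverseBirational (n := 3) (m := 10)
          (EnriquesFano.polyMap fun i => (F i : MvPolynomial (Fin 4) ℂ)) ρ
          Set.univ EnriquesFano.threefold) ∧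
    (∀ F ∈ EnriquesFano.sexticSystem v H, ∀ i j : Fin 4, i ≠ j →
      ∀ a ∈ EnriquesFano.edge v i j, MvPolynomial.eval a F = 0) := by
  obtain ⟨T, hT, hTH⟩ := EnriquesFano.exists_adapted_coordinates v hv H hH hH0 hline hdist
  constructor
  · obtain ⟨F, hF⟩ := EnriquesFano.exists_basis_sexticSystem hT hTH
    refine ⟨F, ?_⟩
    simp only [hF]
    have hmap : ∀ z, EnriquesFano.polyMap (fun i =>
        EnriquesFano.linSubst T.symm.toLinearMap (EnriquesFano.threefoldForm i)) z =
          EnriquesFano.polyMap EnriquesFano.threefoldForm (T.symm z) :=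
      EnriquesFano.polyMap_linSubst _ _
    have himage : EnriquesFano.ratImage (n := 3) (m := 10) (EnriquesFano.polyMap fun i =>
        EnriquesFano.linSubst T.symm.toLinearMap (EnriquesFano.threefoldForm i)) =
          EnriquesFano.threefold := by
      rw [funext hmap, EnriquesFano.ratImage_comp_linearEquiv,
        EnriquesFano.ratImage_threefoldForm]
    refine ⟨himage, T.toLinearMap ∘ₗ EnriquesFano.tetrahedralProjection, ?_, ?_⟩
    · rw [LinearEquiv.ker_comp, EnriquesFano.ker_tetrahedralProjection]
    · rw [← himage]
      refine EnriquesFano.areInverseBirational_of_linear_leftInverse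
        (fun i => EnriquesFano.IsHomogeneous.linSubst _
          (EnriquesFano.threefoldForm_isHomogeneous i)) _
        (EnriquesFano.IsHomogeneous.linSubst T.symm.toLinearMap
          EnriquesFano.projectionFactor_isHomogeneous) (by norm_num) ?_ fun z => ?_
      · intro h0
        apply EnriquesFano.projectionFactor_ne_zero
        rw [← EnriquesFano.linSubst_symm_linSubst T.symm EnriquesFano.projectionFactor]
        exact (congrArg _ h0).trans (map_zero _)
      · rw [hmap, LinearMap.comp_apply, EnriquesFano.tetrahedralProjection_polyMap,
          EnriquesFano.eval_linSubst]
        simp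
  · rintro F hF i j hij a ⟨hai, haj⟩
    obtain ⟨μ, rfl⟩ := EnriquesFano.exists_eq_sum_linSubst_sexticGenerator hT hTH hF
    rw [SetLike.mem_coe, ← T.apply_symm_apply a] at hai haj
    have h := EnriquesFano.eval_sexticGenerator_edge hij
      ((EnriquesFano.map_mem_face_iff hT i _).1 hai) ((EnriquesFano.map_mem_face_iff hT j _).1 haj)
    rw [map_sum]
    refine Finset.sum_eq_zero fun k _ => ?_
    rw [MvPolynomial.smul_eval, EnriquesFano.eval_linSubst]
    simp [h k]
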